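/- Let $K$ be an algebraically closed field of characteristic zero (for instance $K=\mathbb{C}$), let $V$ be a finite-dimensional $K$-vector space with a symmetric bilinear form $(-,-)$, and let $R\subset V$ be an affine generalized root system (AGRS), that is, a non-empty set such that: (0') $\dim\ker(-,-)=1$, $R\cap\ker(-,-)=\emptyset$ and $R$ spans $V$; (1) if $\alpha,\beta\in R$ and $(\alpha,\alpha)\neq0$, then $\frac{2(\alpha,\beta)}{(\alpha,\alpha)}\in\mathbb{Z}$ and $\beta-\frac{2(\alpha,\beta)}{(\alpha,\alpha)}\alpha\in R$; (2) for every $\alpha\in R$ with $(\alpha,\alpha)=0$ there is a bijection $r_\alpha:R\to R$ with $r_\alpha(\pm\alpha)=\mp\alpha$, $r_\alpha(\beta)=\beta$ if $(\alpha,\beta)=0$ and $\beta\ne\pm\alpha$, and $r_\alpha(\beta)\in\{\beta+\alpha,\beta-\alpha\}$ if $(\alpha,\beta)\neq0$; (3) the image $cl(R)$ of $R$ in $V/\ker(-,-)$ is finite; (4) for every $\alpha\in cl(R)$ there is $\delta_\alpha\in\ker(-,-)$ such that any two elements of $R$ with image $\alpha$ differ by an element of $\mathbb{Z}\delta_\alpha$.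 An isomorphism of two such systems, or of two finite systems, is a bijective linear map between the ambient spaces that maps one set of roots onto the other and multiplies the form by a nonzero scalar. Let $n\ge1$ and suppose that $cl(R)$, in $V/\ker(-,-)$ with the induced form, is isomorphic to $$B(0,n)=\{\pm\delta_i,\ \pm2\delta_i,\ \pm\delta_i\pm\delta_j\}_{1\le i\ne j\le n}\subset K^n,\qquad (\delta_i,\delta_j)=-\delta_{i,j}.$$ Then $R$ is isomorphic to the set of real roots of one of the affine Kac-Moody (super)algebras $B(0,n)^{(1)}$, $C(n+1)^{(2)}$, $A_{2n}^{(2)}$, $A(0,2n-1)^{(2)}$ (the latter only for $n\geq2$) or $A(0,2n)^{(4)}$. Here these sets of real roots lie in the space with basis $\delta_1,\dots,\delta_n,\delta$, where $(\delta_i,\delta_j)=-\delta_{i,j}$ and $\delta$ spans the kernel of the form. The simple roots are $\alpha_0$, $\alpha_i=\delta_i-\delta_{i+1}$ for $1\le i<n$, and $\alpha_n=\delta_n$, with - $B(0,n)^{(1)}$: $\alpha_0=\delta-2\delta_1$, odd simple root $\alpha_n$; - $C(n+1)^{(2)}$: $\alpha_0=\delta-\delta_1$, odd simple roots $\alpha_0,\alpha_n$;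 - $A_{2n}^{(2)}$: $\alpha_0=\delta-2\delta_1$, no odd simple root; - $A(0,2n-1)^{(2)}$, $n\ge2$: $\alpha_0=\delta-\delta_1-\delta_2$, odd simple root $\alpha_n$; - $A(0,2n)^{(4)}$: $\alpha_0=\delta-\delta_1$, odd simple root $\alpha_n$; and the real roots are the images, under the group generated by the reflections in the simple roots, of the simple roots and of the doubles of the odd simple roots. -/

import Mathlib

/-- The reflection `r_α(v) = v - (2(α,v)/(α,α)) α` attached to a vector `α` with `(α,α) ≠ 0`. -/
def rootReflection {K V : Type*} [Field K] [AddCommGroup V] [Module K V]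
    (B : LinearMap.BilinForm K V) (α v : V) : V :=
  v - (2 * B α v / B α α) • α

/-- Affine generalized root systems: `R` is a set of vectors in the finite-dimensional space `V`
with the symmetric bilinear form `B`. The kernel `ker(-,-)` of the form is `LinearMap.ker B`, and
`cl` is the quotient map `(LinearMap.ker B).mkQ` restricted to `R`. -/
structure IsAGRS {K V : Type*} [Field K] [AddCommGroup V] [Module K V]
    (B : LinearMap.BilinForm K V) (R : Set V) : Prop where
  finiteDimensional : FiniteDimensional K V
  symm : B.IsSymm
  nonempty : R.Nonempty
  finrank_ker : Module.finrank K (LinearMap.ker B) = 1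
  notMem_ker : ∀ α ∈ R, α ∉ LinearMap.ker B
  span_eq_top : Submodule.span K R = ⊤
  reflection : ∀ α ∈ R, B α α ≠ 0 → ∀ β ∈ R,
    (∃ m : ℤ, 2 * B α β / B α α = (m : K)) ∧ rootReflection B α β ∈ R
  odd_reflection : ∀ α ∈ R, B α α = 0 → ∃ r : R ≃ R, ∀ β : R,
    ((β : V) = α → (r β : V) = -α) ∧
    ((β : V) = -α → (r β : V) = α) ∧
    (B α β = 0 → (β : V) ≠ α → (β : V) ≠ -α → r β = β) ∧
    (B α β ≠ 0 → (r β : V) = β + α ∨ (r β : V) = β - α)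
  finite_cl : ((LinearMap.ker B).mkQ '' R).Finite
  discrete : ∀ α ∈ (LinearMap.ker B).mkQ '' R, ∃ d ∈ LinearMap.ker B,
    ∀ α' ∈ R, ∀ α'' ∈ R, (LinearMap.ker B).mkQ α' = α → (LinearMap.ker B).mkQ α'' = α →
      ∃ m : ℤ, α'' - α' = m • d

/-- Isomorphism of systems `R ⊆ V` and `R' ⊆ V'`: a bijective linear map which carries `R` onto
`R'` and the form to a nonzero scalar multiple of the form. -/
def SystemIso {K V V' : Type*} [Field K] [AddCommGroup V] [Module K V]
    [AddCommGroup V'] [Module K V']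
    (B : LinearMap.BilinForm K V) (R : Set V) (B' : LinearMap.BilinForm K V') (R' : Set V') :
    Prop :=
  ∃ ψ : V ≃ₗ[K] V', ψ '' R = R' ∧ ∃ a : K, a ≠ 0 ∧ ∀ v w, B' (ψ v) (ψ w) = a * B v w

/-- The form induced by a symmetric form on the quotient by its kernel. -/
def quotForm {K V : Type*} [Field K] [AddCommGroup V] [Module K V]
    (B : LinearMap.BilinForm K V) (hB : B.IsSymm) :
    LinearMap.BilinForm K (V ⧸ LinearMap.ker B) :=
  LinearMap.IsRefl.liftQ₂ B (LinearMap.ker B) hB.isRefl le_rfl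

/-- The form on the space with basis `δ_1, …, δ_n` given by `(δ_i, δ_j) = -1` if `i = j` and
`(δ_i, δ_j) = 0` otherwise. -/
def deltaForm (K : Type*) [Field K] (n : ℕ) : LinearMap.BilinForm K (Fin n → K) :=
  LinearMap.mk₂ K (fun x y => -∑ i, x i * y i)
    (fun x x' y => by simp [add_mul, Finset.sum_add_distrib, add_comm])
    (fun c x y => by simp [mul_assoc, Finset.mul_sum])
    (fun x y y' => by simp [mul_add, Finset.sum_add_distrib, add_comm])
    (fun c x y => by simp [mul_left_comm, Finset.mul_sum])

/-- The finite root system `B(0,n) = BC_n = {±δ_i, ±δ_i ± δ_j, ±2δ_i}` (`i ≠ j`). -/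
def rootsB0 (K : Type*) [Field K] (n : ℕ) : Set (Fin n → K) :=
  {v | ∃ i, ∃ s ∈ ({1, -1} : Set K),
    v = Pi.single i s ∨ v = Pi.single i (2 * s) ∨
      ∃ j, j ≠ i ∧ ∃ t ∈ ({1, -1} : Set K), v = Pi.single i s + Pi.single j t}

/-- The form on the space with basis `δ_1, …, δ_n, δ` that extends `deltaForm` and has `δ` in its
kernel; the element `(x, c)` stands for `∑ i, x_i δ_i + c δ`. -/
def affineForm (K : Type*) [Field K] (n : ℕ) : LinearMap.BilinForm K ((Fin n → K) × K) :=
  (deltaForm K n).compl₁₂ (LinearMap.fst K (Fin n → K) K) (LinearMap.fst K (Fin n → K) K)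

/-- The set of real roots of the symmetrizable Kac-Moody superalgebra with simple roots `a i` (none
of them isotropic for `B`) of which those with index in `odd` are odd: its Cartan matrix is
`2 (a i, a j) / (a i, a i)`. The real roots are the images under the Weyl group, which is generated
by the simple reflections, of the simple roots and of the doubles of the odd simple roots. -/
inductive IsRealRoot {K V ι : Type*} [Field K] [AddCommGroup V] [Module K V]
    (B : LinearMap.BilinForm K V) (a : ι → V) (odd : Set ι) : V → Prop
  | simple (i : ι) : IsRealRoot B a odd (a i)
  | double (i : ι) (hi : i ∈ odd) : IsRealRoot B a odd ((2 : K) • a i)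
  | reflect (i : ι) (v : V) (hv : IsRealRoot B a odd v) :
      IsRealRoot B a odd (rootReflection B (a i) v)

/-- With zero-based indices, `deltaVec K n k` is the basis vector `δ_{k+1}` if `k < n`; it is `0` if
`n ≤ k`. -/
def deltaVec (K : Type*) [Field K] (n k : ℕ) : Fin n → K :=
  fun i => if (i : ℕ) = k then 1 else 0

/-- The simple roots `α_0, α_1, …, α_n` where `α_0 = a₀` is given, `α_i = δ_i - δ_{i+1}` for
`1 ≤ i < n`, and `α_n = δ_n`. -/
def affineSimpleRoots (K : Type*) [Field K] (n : ℕ) (a₀ : (Fin n → K) × K) :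
    Fin (n + 1) → (Fin n → K) × K :=
  Fin.cons a₀ (fun i : Fin n => (deltaVec K n i - deltaVec K n (i + 1), 0))

/-- Real roots of `B(0,n)^{(1)}`: `α_0 = δ - 2δ_1`, and `α_n` is the only odd simple root. -/
def realRootsB0 (K : Type*) [Field K] (n : ℕ) : Set ((Fin n → K) × K) :=
  {v | IsRealRoot (affineForm K n)
    (affineSimpleRoots K n (-((2 : K) • deltaVec K n 0), 1)) {Fin.last n} v}

/-- Real roots of `C(n+1)^{(2)}`: `α_0 = δ - δ_1`, and `α_0`, `α_n` are the odd simple roots. -/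
def realRootsC2 (K : Type*) [Field K] (n : ℕ) : Set ((Fin n → K) × K) :=
  {v | IsRealRoot (affineForm K n)
    (affineSimpleRoots K n (-deltaVec K n 0, 1)) {0, Fin.last n} v}

/-- Real roots of the Lie algebra `A_{2n}^{(2)}`: `α_0 = δ - 2δ_1`, without odd simple roots. -/
def realRootsA2 (K : Type*) [Field K] (n : ℕ) : Set ((Fin n → K) × K) :=
  {v | IsRealRoot (affineForm K n)
    (affineSimpleRoots K n (-((2 : K) • deltaVec K n 0), 1)) ∅ v}

/-- Real roots of `A(0,2n-1)^{(2)}`, for `2 ≤ n`: `α_0 = δ - δ_1 - δ_2`, and `α_n` is the only odd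
simple root. -/
def realRootsA0odd2 (K : Type*) [Field K] (n : ℕ) : Set ((Fin n → K) × K) :=
  {v | IsRealRoot (affineForm K n)
    (affineSimpleRoots K n (-deltaVec K n 0 - deltaVec K n 1, 1)) {Fin.last n} v}

/-- Real roots of `A(0,2n)^{(4)}`: `α_0 = δ - δ_1`, and `α_n` is the only odd simple root. -/
def realRootsA0even4 (K : Type*) [Field K] (n : ℕ) : Set ((Fin n → K) × K) :=
  {v | IsRealRoot (affineForm K n)
    (affineSimpleRoots K n (-deltaVec K n 0, 1)) {Fin.last n} v}

/-! Lift `δ_1` and all `δ_i - δ_1` to roots of `R`. These lifts together with a generator of the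
kernel give linear coordinates in which the chosen roots have level `0`, the level being the
coefficient of `δ` (`exists_normalizedSystem`). No root is isotropic, so all reflections are
available. Those in the chosen roots generate the signed permutations of the `δ_i`, leaving levels
unchanged. Hence `R` is determined by three level sets `S`, `M`, `L` over the short, medium and long
vectors.

Reflections constrain these sets. Discreteness and `S - 2S ⊆ S` make `S` cyclic, and spanning makes
it nonzero, so rescaling `δ` gives `S = ℤ`. Then `L` is invariant under `4ℤ` and under `y ↦ y - 2x`
for `x ∈ L`, so it is one of `ℤ`, `2ℤ`, `2ℤ+1`, `4ℤ`, `4ℤ+2`. If `n ≥ 2`, then `M` contains `0` and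
is invariant under `2ℤ`, so it is `ℤ` or `2ℤ`; moreover `L ⊆ M` and `L + 2M ⊆ L`. Six combinations
survive (`exists_mem_iff_mem_layered`). The shear `δ_i ↦ δ_i + δ` identifies `L = 4ℤ+2` with `L =
4ℤ`, leaving five.

On the other side, the real roots of each algebra are also layered. Reflection in `α_0` followed by
a signed permutation is a translation of levels, and the translates of the simple roots and the
doubled odd ones fill exactly the five combinations (`realRoots_eq_layered_of_single`,
`realRootsA0odd2_eq_layered`). -/

theorem affineForm_apply {K : Type*} [Field K] {n : ℕ} (p q : (Fin n → K) × K) :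
    affineForm K n p q = -∑ i, p.1 i * q.1 i := rfl

/-! ### Layers of an affine system over `B(0,n)`. -/

/-- The vectors `±δ_i`. -/
def shortVectors (K : Type*) [Field K] (n : ℕ) : Set (Fin n → K) :=
  {v | ∃ i, ∃ s ∈ ({1, -1} : Set K), v = Pi.single i s}

/-- The vectors `±δ_i ± δ_j` with `i ≠ j`. -/
def mediumVectors (K : Type*) [Field K] (n : ℕ) : Set (Fin n → K) :=
  {v | ∃ i, ∃ s ∈ ({1, -1} : Set K), ∃ j, j ≠ i ∧ ∃ t ∈ ({1, -1} : Set K),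
    v = Pi.single i s + Pi.single j t}

/-- The vectors `±2δ_i`. -/
def longVectors (K : Type*) [Field K] (n : ℕ) : Set (Fin n → K) :=
  {v | ∃ i, ∃ s ∈ ({1, -1} : Set K), v = Pi.single i (2 * s)}

theorem mem_rootsB0_iff {K : Type*} [Field K] {n : ℕ} {v : Fin n → K} :
    v ∈ rootsB0 K n ↔
      v ∈ shortVectors K n ∨ v ∈ mediumVectors K n ∨ v ∈ longVectors K n := by
  constructor
  · rintro ⟨i, s, hs, h | h | ⟨j, hj, t, ht, h⟩⟩
    · exact .inl ⟨i, s, hs, h⟩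
    · exact .inr (.inr ⟨i, s, hs, h⟩)
    · exact .inr (.inl ⟨i, s, hs, j, hj, t, ht, h⟩)
  · rintro (⟨i, s, hs, h⟩ | ⟨i, s, hs, j, hj, t, ht, h⟩ | ⟨i, s, hs, h⟩)
    · exact ⟨i, s, hs, .inl h⟩
    · exact ⟨i, s, hs, .inr (.inr ⟨j, hj, t, ht, h⟩)⟩
    · exact ⟨i, s, hs, .inr (.inl h)⟩

/-- The set of `v + c δ` where `v` is short, medium or long and `c` lies in `S`, `M` or `L`
accordingly. -/
def layered {K : Type*} [Field K] (n : ℕ) (S M L : Set K) : Set ((Fin n → K) × K) :=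
  {p | (p.1 ∈ shortVectors K n ∧ p.2 ∈ S) ∨ (p.1 ∈ mediumVectors K n ∧ p.2 ∈ M) ∨
    (p.1 ∈ longVectors K n ∧ p.2 ∈ L)}

/-- The arithmetic progression `m ℤ + r`. -/
def progression (K : Type*) [Field K] (m r : ℤ) : Set K := {c | ∃ k : ℤ, c = ((m * k + r : ℤ) : K)}

theorem intCast_mem_progression {K : Type*} [Field K] [CharZero K] {m r k : ℤ} :
    (k : K) ∈ progression K m r ↔ m ∣ k - r := by
  constructor
  · rintro ⟨l, h⟩
    exact ⟨l, by linarith [Int.cast_injective h]⟩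
  · rintro ⟨l, h⟩
    exact ⟨l, congrArg _ (by linarith)⟩

theorem exists_intCast_eq {K : Type*} [Field K] {m r : ℤ} {c : K}
    (hc : c ∈ progression K m r) : ∃ k : ℤ, c = k := by
  obtain ⟨k, rfl⟩ := hc
  exact ⟨_, rfl⟩

/-! ### Reflections in coordinates and signed permutations. -/

/-- Invariance under the signed permutations of `δ_1, …, δ_n`. -/
structure IsSignedPermInvariant {K : Type*} [Field K] {n : ℕ} (X : Set ((Fin n → K) × K)) :
    Prop where
  perm : ∀ (σ : Equiv.Perm (Fin n)) (y : Fin n → K) (c : K), (y, c) ∈ X → (y ∘ σ, c) ∈ X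
  flip : ∀ (i : Fin n) (y : Fin n → K) (c : K), (y, c) ∈ X → (Function.update y i (-y i), c) ∈ X

theorem rootReflection_single {K : Type*} [Field K] [CharZero K] {n : ℕ} (i : Fin n) {a : K}
    (ha : a ≠ 0) (c : K) (y : Fin n → K) (d : K) :
    rootReflection (affineForm K n) (Pi.single i a, c) (y, d) =
      (Function.update y i (-y i), d - 2 * y i / a * c) := by
  have h : ∀ y : Fin n → K, ∑ k, (Pi.single i a : Fin n → K) k * y k = a * y i := fun y => by
    simp [Pi.single_apply]
  simp only [rootReflection, affineForm_apply, h]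
  have h2 : 2 * -(a * y i) / -(a * (Pi.single i a : Fin n → K) i) = 2 * y i / a := by
    simp; field_simp
  rw [h2]
  ext k
  · by_cases hk : k = i
    · subst hk; simp; field_simp; ring
    · simp [hk]
  · simp

theorem rootReflection_add_single {K : Type*} [Field K] [CharZero K] {n : ℕ} {i j : Fin n}
    (hij : j ≠ i) {s t : K} (hs : s ∈ ({1, -1} : Set K)) (ht : t ∈ ({1, -1} : Set K)) (c : K)
    (y : Fin n → K) (d : K) :
    rootReflection (affineForm K n) (Pi.single i s + Pi.single j t, c) (y, d) =
      (y - (s * y i + t * y j) • (Pi.single i s + Pi.single j t),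
        d - (s * y i + t * y j) * c) := by
  have h : ∀ y : Fin n → K, ∑ k, (Pi.single i s + Pi.single j t : Fin n → K) k * y k =
      s * y i + t * y j := fun y => by
    simp [Pi.single_apply, add_mul, Finset.sum_add_distrib]
  simp only [rootReflection, affineForm_apply, h]
  have h2 : 2 * -(s * y i + t * y j) / -(s * (Pi.single i s + Pi.single j t : Fin n → K) i +
      t * (Pi.single i s + Pi.single j t : Fin n → K) j) = s * y i + t * y j := by
    have hs' : s * s = 1 := by rcases hs with rfl | rfl <;> simp
    have ht' : t * t = 1 := by rcases ht with rfl | rfl <;> simp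
    simp [hij, hij.symm, hs', ht']
    field_simp
    ring
  rw [h2]
  rfl

theorem sub_smul_eq_comp_swap {K : Type*} [Field K] {n : ℕ} {i j : Fin n} (hij : j ≠ i)
    (y : Fin n → K) :
    y - ((1 : K) * y i + -1 * y j) • (Pi.single i 1 + Pi.single j (-1)) = y ∘ Equiv.swap i j := by
  ext k
  by_cases hi : k = i
  · subst hi; simp [hij.symm]
  by_cases hj : k = j
  · subst hj; simp [hij]
  · simp [hi, hj, Equiv.swap_apply_of_ne_of_ne]

theorem rootReflection_sub_single {K : Type*} [Field K] [CharZero K] {n : ℕ} {i j : Fin n}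
    (hij : j ≠ i) (c : K) (y : Fin n → K) (d : K) :
    rootReflection (affineForm K n) (Pi.single i 1 + Pi.single j (-1), c) (y, d) =
      (y ∘ Equiv.swap i j, d - (y i - y j) * c) := by
  rw [rootReflection_add_single hij (by simp) (by simp), sub_smul_eq_comp_swap hij]
  simp [sub_eq_add_neg]

theorem rootReflection_neg_sub_single {K : Type*} [Field K] [CharZero K] {n : ℕ} {i j : Fin n}
    (hij : j ≠ i) (c : K) (y : Fin n → K) (d : K) :
    rootReflection (affineForm K n) (Pi.single i (-1) + Pi.single j (-1), c) (y, d) =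
      (Function.update (Function.update (y ∘ Equiv.swap i j) i (-y j)) j (-y i),
        d + (y i + y j) * c) := by
  rw [rootReflection_add_single hij (by simp) (by simp)]
  ext k
  · by_cases hi : k = i
    · subst hi; simp [hij.symm]
    by_cases hj : k = j
    · subst hj; simp [hij]
    · simp [hi, hj, Equiv.swap_apply_of_ne_of_ne]
  · simp; ring

theorem single_comp_perm {K : Type*} [Field K] {n : ℕ} (i : Fin n) (a : K)
    (σ : Equiv.Perm (Fin n)) :
    (Pi.single i a : Fin n → K) ∘ σ = Pi.single (σ.symm i) a := by
  ext k
  simp [Pi.single_apply, Equiv.eq_symm_apply]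

theorem update_single_same {K : Type*} [Field K] {n : ℕ} (i : Fin n) (a : K) :
    Function.update (Pi.single i a : Fin n → K) i (-(Pi.single i a : Fin n → K) i) =
      Pi.single i (-a) := by
  ext k
  by_cases hk : k = i
  · subst hk; simp
  · simp [hk]

theorem update_single_of_ne {K : Type*} [Field K] {n : ℕ} {i j : Fin n} (hij : i ≠ j) (a : K) :
    Function.update (Pi.single i a : Fin n → K) j (-(Pi.single i a : Fin n → K) j) =
      Pi.single i a := by
  rw [Pi.single_eq_of_ne hij.symm, neg_zero]
  conv_rhs => rw [← Function.update_eq_self j (Pi.single i a : Fin n → K)]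
  rw [Pi.single_eq_of_ne hij.symm]

theorem update_neg_add {K : Type*} [Field K] {n : ℕ} (x y : Fin n → K) (i : Fin n) :
    Function.update (x + y) i (-(x + y) i) =
      Function.update x i (-x i) + Function.update y i (-y i) := by
  ext k
  by_cases hk : k = i
  · subst hk; simp; ring
  · simp [hk]

theorem neg_mem_signs {K : Type*} [Field K] {s : K} (hs : s ∈ ({1, -1} : Set K)) :
    -s ∈ ({1, -1} : Set K) := by
  rcases hs with rfl | rfl <;> simp

/-- The factor `a` is `1` for short and medium vectors and `2` for long ones. -/
theorem update_single_neg {K : Type*} [Field K] {n : ℕ} (i k : Fin n) {s : K}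
    (hs : s ∈ ({1, -1} : Set K)) :
    ∃ t ∈ ({1, -1} : Set K), ∀ a : K,
      Function.update (Pi.single i (a * s) : Fin n → K) k (-(Pi.single i (a * s) : Fin n → K) k) =
      Pi.single i (a * t) := by
  by_cases hk : i = k
  · subst hk
    exact ⟨-s, neg_mem_signs hs, fun a => by rw [update_single_same, mul_neg]⟩
  · exact ⟨s, hs, fun a => update_single_of_ne hk _⟩

theorem isSignedPermInvariant_layered {K : Type*} [Field K] {n : ℕ} (S M L : Set K) :
    IsSignedPermInvariant (layered n S M L) where
  perm := by
    rintro σ y c (⟨⟨i, s, hs, hy⟩, hc⟩ | ⟨⟨i, s, hs, j, hj, t, ht, hy⟩, hc⟩ | ⟨⟨i, s, hs, hy⟩, hc⟩)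
    · exact .inl ⟨⟨σ.symm i, s, hs, by rw [← single_comp_perm]; exact congrArg (· ∘ σ) hy⟩, hc⟩
    · refine .inr (.inl ⟨⟨σ.symm i, s, hs, σ.symm j, by simpa using hj, t, ht, ?_⟩, hc⟩)
      rw [← single_comp_perm, ← single_comp_perm]
      exact congrArg (· ∘ σ) hy
    · exact .inr (.inr ⟨⟨σ.symm i, s, hs, by
        rw [← single_comp_perm]; exact congrArg (· ∘ σ) hy⟩, hc⟩)
  flip := by
    rintro k y c (⟨⟨i, s, hs, hy⟩, hc⟩ | ⟨⟨i, s, hs, j, hj, t, ht, hy⟩, hc⟩ | ⟨⟨i, s, hs, hy⟩, hc⟩)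
    · obtain ⟨s', hs', h⟩ := update_single_neg i k hs
      have := h 1
      simp only [one_mul] at this
      refine .inl ⟨⟨i, s', hs', ?_⟩, hc⟩
      dsimp only at hy ⊢
      rw [hy, this]
    · obtain ⟨s', hs', h⟩ := update_single_neg i k hs
      obtain ⟨t', ht', h'⟩ := update_single_neg j k ht
      have h1 := h 1
      have h2 := h' 1
      rw [one_mul, one_mul] at h1 h2
      refine .inr (.inl ⟨⟨i, s', hs', j, hj, t', ht', ?_⟩, hc⟩)
      dsimp only at hy ⊢
      rw [hy, update_neg_add, h1, h2]
    · obtain ⟨s', hs', h⟩ := update_single_neg i k hs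
      refine .inr (.inr ⟨⟨i, s', hs', ?_⟩, hc⟩)
      dsimp only at hy ⊢
      rw [hy, h]

/-! ### Transitivity of signed permutations on each length class. -/

namespace IsSignedPermInvariant

variable {K : Type*} [Field K] {n : ℕ} {X : Set ((Fin n → K) × K)}

theorem of_flip (hX : IsSignedPermInvariant X) {i : Fin n} {y : Fin n → K} {c : K}
    (h : (Function.update y i (-y i), c) ∈ X) : (y, c) ∈ X := by
  have := hX.flip i _ _ h
  simpa using this

theorem flip_neg (hX : IsSignedPermInvariant X) {i : Fin n} {a c : K} {z : Fin n → K}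
    (hz : z i = 0) (h : (Pi.single i a + z, c) ∈ X) : (Pi.single i (-a) + z, c) ∈ X := by
  have := hX.flip i _ _ h
  rwa [update_neg_add, update_single_same, hz, neg_zero,
    show Function.update z i 0 = z by rw [← hz, Function.update_eq_self]] at this

theorem flip_sign (hX : IsSignedPermInvariant X) {i : Fin n} {a c s t : K} {z : Fin n → K}
    (hs : s ∈ ({1, -1} : Set K)) (ht : t ∈ ({1, -1} : Set K))
    (hz : z i = 0) (h : (Pi.single i (a * s) + z, c) ∈ X) :
    (Pi.single i (a * t) + z, c) ∈ X := by
  have h' := hX.flip_neg hz h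
  rcases hs with rfl | rfl <;> rcases ht with rfl | rfl <;> simp at h h' ⊢ <;> assumption

theorem single_mem (hX : IsSignedPermInvariant X) {i j : Fin n} {a c s t : K}
    (hs : s ∈ ({1, -1} : Set K)) (ht : t ∈ ({1, -1} : Set K))
    (h : (Pi.single i (a * s), c) ∈ X) : (Pi.single j (a * t), c) ∈ X := by
  have h1 := hX.perm (Equiv.swap i j) _ _ h
  rw [single_comp_perm, Equiv.symm_swap, Equiv.swap_apply_left] at h1
  simpa using hX.flip_sign (z := 0) hs ht rfl (by simpa using h1)

theorem mem_of_short (hX : IsSignedPermInvariant X) {x y : Fin n → K} {c : K}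
    (hx : x ∈ shortVectors K n) (hy : y ∈ shortVectors K n) (h : (x, c) ∈ X) : (y, c) ∈ X := by
  obtain ⟨i, s, hs, rfl⟩ := hx
  obtain ⟨j, t, ht, rfl⟩ := hy
  simpa using hX.single_mem (a := 1) (j := j) hs ht (by simpa using h)

theorem mem_of_long (hX : IsSignedPermInvariant X) {x y : Fin n → K} {c : K}
    (hx : x ∈ longVectors K n) (hy : y ∈ longVectors K n) (h : (x, c) ∈ X) : (y, c) ∈ X := by
  obtain ⟨i, s, hs, rfl⟩ := hx
  obtain ⟨j, t, ht, rfl⟩ := hy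
  exact hX.single_mem hs ht h

theorem mem_of_medium (hX : IsSignedPermInvariant X) {x y : Fin n → K} {c : K}
    (hx : x ∈ mediumVectors K n) (hy : y ∈ mediumVectors K n) (h : (x, c) ∈ X) : (y, c) ∈ X := by
  obtain ⟨i, s, hs, j, hij, t, ht, rfl⟩ := hx
  obtain ⟨k, s', hs', l, hkl, t', ht', rfl⟩ := hy
  obtain ⟨σ, h1, h2⟩ : ∃ σ : Equiv.Perm (Fin n), σ.symm i = k ∧ σ.symm j = l := by
    -- Swapping `i` and `k` puts `i` in place and moves `j` to some index other than `k`. The second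
    -- swap takes that index to `l` and fixes `k`.
    refine ⟨(Equiv.swap (Equiv.swap i k j) l * Equiv.swap i k).symm, ?_, ?_⟩
    · rw [Equiv.symm_symm, Equiv.Perm.mul_apply, Equiv.swap_apply_left,
        Equiv.swap_apply_of_ne_of_ne _ hkl.symm]
      intro h
      exact hij ((Equiv.swap i k).injective (by rw [← h, Equiv.swap_apply_left]))
    · simp
  have h3 : (Pi.single k s + Pi.single l t, c) ∈ X := by
    have := hX.perm σ _ _ h
    rwa [Pi.add_comp, single_comp_perm, single_comp_perm, h1, h2] at this
  have h4 := hX.flip_sign (a := 1) (z := Pi.single l t) hs hs' (Pi.single_eq_of_ne hkl.symm _) (by rwa [one_mul])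
  rw [one_mul, add_comm] at h4
  have h5 := hX.flip_sign (a := 1) (z := Pi.single k s') ht ht' (Pi.single_eq_of_ne hkl _) (by rwa [one_mul])
  rwa [add_comm, one_mul] at h5

/-- By transitivity one root per length and level suffices. The medium condition is guarded because
there are no medium vectors when `n = 1`. -/
theorem layered_subset (hX : IsSignedPermInvariant X) {S M L : Set K}
    (hS : ∀ c ∈ S, ∃ x ∈ shortVectors K n, (x, c) ∈ X)
    (hM : (mediumVectors K n).Nonempty → ∀ c ∈ M, ∃ x ∈ mediumVectors K n, (x, c) ∈ X)
    (hL : ∀ c ∈ L, ∃ x ∈ longVectors K n, (x, c) ∈ X) : layered n S M L ⊆ X := by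
  rintro ⟨y, c⟩ (⟨hy, hc⟩ | ⟨hy, hc⟩ | ⟨hy, hc⟩)
  · obtain ⟨x, hx, h⟩ := hS c hc
    exact hX.mem_of_short hx hy h
  · obtain ⟨x, hx, h⟩ := hM ⟨_, hy⟩ c hc
    exact hX.mem_of_medium hx hy h
  · obtain ⟨x, hx, h⟩ := hL c hc
    exact hX.mem_of_long hx hy h

end IsSignedPermInvariant

/-! ### Real roots: the finite simple reflections. -/

theorem deltaVec_eq_single {K : Type*} [Field K] {n : ℕ} (i : Fin n) :
    deltaVec K n i = Pi.single i 1 := by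
  ext k
  simp [deltaVec, Pi.single_apply, Fin.ext_iff]

theorem affineSimpleRoots_castSucc {K : Type*} [Field K] {m : ℕ} (a₀ : (Fin (m + 1) → K) × K)
    (i : Fin m) :
    affineSimpleRoots K (m + 1) a₀ i.castSucc.succ =
      (Pi.single i.castSucc 1 + Pi.single i.succ (-1), 0) := by
  simp only [affineSimpleRoots, Fin.cons_succ]
  rw [deltaVec_eq_single, Fin.val_castSucc, ← Fin.val_succ, deltaVec_eq_single, Pi.single_neg,
    sub_eq_add_neg]

theorem affineSimpleRoots_last {K : Type*} [Field K] {m : ℕ} (a₀ : (Fin (m + 1) → K) × K) :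
    affineSimpleRoots K (m + 1) a₀ (Fin.last (m + 1)) = (Pi.single (Fin.last m) 1, 0) := by
  rw [← Fin.succ_last]
  simp only [affineSimpleRoots, Fin.cons_succ]
  rw [deltaVec_eq_single]
  -- The index runs past the end, so the uniform formula `δ_i - δ_{i+1}` gives `δ_n` for the last
  -- simple root.
  have : deltaVec K (m + 1) (↑(Fin.last m) + 1) = 0 := by
    ext k
    simpa [deltaVec] using fun h => absurd k.2 (by omega)
  rw [this, sub_zero]

section RealRoots

variable {K : Type*} [Field K] [CharZero K] {m : ℕ} {a₀ : (Fin (m + 1) → K) × K}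
  {odd : Set (Fin (m + 2))}

/-- The simple roots other than `α_0` have level `0`: those of the form `δ_i - δ_{i+1}` act as
adjacent transpositions, which generate all permutations, and `δ_n` flips the last sign. Conjugation
by a transposition flips any other sign. -/
theorem isSignedPermInvariant_realRoots :
    IsSignedPermInvariant
      {v | IsRealRoot (affineForm K (m + 1)) (affineSimpleRoots K (m + 1) a₀) odd v} := by
  have hperm : ∀ (σ : Equiv.Perm (Fin (m + 1))) (y : Fin (m + 1) → K) (c : K),
      (y, c) ∈ {v | IsRealRoot (affineForm K (m + 1)) (affineSimpleRoots K (m + 1) a₀) odd v} →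
      (y ∘ σ, c) ∈
        {v | IsRealRoot (affineForm K (m + 1)) (affineSimpleRoots K (m + 1) a₀) odd v} := by
    intro σ
    have hσ : σ ∈ Submonoid.closure
        (Set.range fun i : Fin m => Equiv.swap i.castSucc i.succ) := by
      rw [Equiv.Perm.mclosure_swap_castSucc_succ]; trivial
    induction hσ using Submonoid.closure_induction with
    | mem σ h =>
      obtain ⟨i, rfl⟩ := h
      intro y c h
      have := IsRealRoot.reflect i.castSucc.succ _ h
      rwa [affineSimpleRoots_castSucc, rootReflection_sub_single i.castSucc_lt_succ.ne',
        mul_zero, sub_zero] at this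
    | one => exact fun y c h => h
    | mul σ τ _ _ h1 h2 => exact fun y c h => h2 _ c (h1 _ c h)
  refine ⟨hperm, fun i y c h => ?_⟩
  have h1 := IsRealRoot.reflect (Fin.last (m + 1)) _ (hperm (Equiv.swap i (Fin.last m)) _ _ h)
  rw [affineSimpleRoots_last, rootReflection_single _ one_ne_zero, mul_zero, sub_zero] at h1
  convert hperm (Equiv.swap i (Fin.last m)) _ _ h1 using 2
  ext k
  by_cases hk : k = i
  · subst hk; simp
  · have : Equiv.swap i (Fin.last m) k ≠ Fin.last m := fun h => hk
      ((Equiv.swap i (Fin.last m)).injective (by rw [h, Equiv.swap_apply_left]))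
    simp [hk, this]

/-- For a set invariant under signed permutations, only stability under the reflection in `α_0`
remains to be checked. -/
theorem realRoots_subset {N : Set ((Fin (m + 1) → K) × K)} (hN : IsSignedPermInvariant N)
    (h0 : a₀ ∈ N) (h0' : ∀ p ∈ N, rootReflection (affineForm K (m + 1)) a₀ p ∈ N)
    (hshort : (Pi.single (Fin.last m) 1, 0) ∈ N)
    (hmed : ∀ i : Fin m, (Pi.single i.castSucc 1 + Pi.single i.succ (-1), 0) ∈ N)
    (hodd : ∀ i ∈ odd, (2 : K) • affineSimpleRoots K (m + 1) a₀ i ∈ N) :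
    {v | IsRealRoot (affineForm K (m + 1)) (affineSimpleRoots K (m + 1) a₀) odd v} ⊆ N := by
  intro v hv
  induction hv with
  | simple i =>
    refine Fin.cases h0 (fun j => ?_) i
    refine Fin.lastCases ?_ (fun j => ?_) j
    · rwa [Fin.succ_last, affineSimpleRoots_last]
    · rw [affineSimpleRoots_castSucc]; exact hmed j
  | double i hi => exact hodd i hi
  | reflect i v _ ih =>
    refine Fin.cases (h0' v ih) (fun j => ?_) i
    refine Fin.lastCases ?_ (fun j => ?_) j
    · rw [Fin.succ_last, affineSimpleRoots_last, rootReflection_single _ one_ne_zero, mul_zero,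
        sub_zero]
      exact hN.flip _ _ _ ih
    · rw [affineSimpleRoots_castSucc, rootReflection_sub_single j.castSucc_lt_succ.ne', mul_zero,
        sub_zero]
      exact hN.perm _ _ _ ih

end RealRoots

/-! ### Translations of levels produced by the affine reflection. -/

section Translations

variable {K : Type*} [Field K] {n : ℕ} {X : Set ((Fin n → K) × K)}

/-- Undoing the sign change at `i` turns the reflection into the translation of the level by `2 y_i
/ a`. -/
theorem rootReflection_single_mem_iff [CharZero K] (hX : IsSignedPermInvariant X) (i : Fin n) {a : K}
    (ha : a ≠ 0) (y : Fin n → K) (d : K) :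
    rootReflection (affineForm K n) (Pi.single i (-a), 1) (y, d) ∈ X ↔
      (y, d + 2 * y i / a) ∈ X := by
  rw [rootReflection_single _ (neg_ne_zero.2 ha),
    show d - 2 * y i / -a * 1 = d + 2 * y i / a by field_simp; ring]
  exact ⟨hX.of_flip, hX.flip i _ _⟩

theorem rootReflection_neg_sub_single_mem_iff [CharZero K] (hX : IsSignedPermInvariant X) {i j : Fin n}
    (hij : j ≠ i) (y : Fin n → K) (d : K) :
    rootReflection (affineForm K n) (Pi.single i (-1) + Pi.single j (-1), 1) (y, d) ∈ X ↔
      (y, d + (y i + y j)) ∈ X := by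
  rw [rootReflection_neg_sub_single hij, mul_one]
  refine ⟨fun h => ?_, fun h => ?_⟩
  · have := hX.perm (Equiv.swap i j) _ _ (hX.flip i _ _ (hX.flip j _ _ h))
    convert this using 2
    ext k
    by_cases hi : k = i
    · subst hi; simp [Function.update_apply, hij]
    by_cases hj : k = j
    · subst hj; simp [hij.symm]
    · simp [hi, hj, Equiv.swap_apply_of_ne_of_ne]
  · have := hX.flip j _ _ (hX.flip i _ _ (hX.perm (Equiv.swap i j) _ _ h))
    simpa [hij] using this

/-- Carry the root from `x` to `z`, translate its level by `e z = q`, and carry it back; using `-z`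
instead lowers the level by `q`. One root at level `r` thus yields the whole progression. -/
theorem exists_mem_of_mem_progression {T : Set (Fin n → K)} {e : (Fin n → K) → K}
    (hT : ∀ x ∈ T, ∀ y ∈ T, ∀ c, (x, c) ∈ X → (y, c) ∈ X)
    (he : ∀ y d, (y, d) ∈ X → (y, d + e y) ∈ X) {z : Fin n → K} (hz : z ∈ T) (hz' : -z ∈ T)
    (hneg : e (-z) = -e z) {q r : ℤ} (hq : e z = q) {x : Fin n → K} (hx : x ∈ T)
    (hr : (x, (r : K)) ∈ X) : ∀ c ∈ progression K q r, ∃ x ∈ T, (x, c) ∈ X := by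
  rintro c ⟨k, rfl⟩
  refine ⟨x, hx, ?_⟩
  induction k using Int.induction_on with
  | zero => simpa using hr
  | succ k ih =>
    have := hT _ hz x hx _ (he _ _ (hT x hx _ hz _ ih))
    rw [hq] at this
    convert this using 2
    push_cast; ring
  | pred k ih =>
    have := hT _ hz' x hx _ (he _ _ (hT x hx _ hz' _ ih))
    rw [hneg, hq] at this
    convert this using 2
    push_cast; ring

theorem mem_progression_cases {q r : ℤ} {c : K} (hc : c ∈ progression K q r) :
    c ∈ progression K (2 * q) r ∨ c ∈ progression K (2 * q) (q + r) := by
  obtain ⟨k, rfl⟩ := hc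
  obtain ⟨l, rfl | rfl⟩ := k.even_or_odd'
  · exact .inl ⟨l, by push_cast; ring⟩
  · exact .inr ⟨l, by push_cast; ring⟩

theorem exists_intCast_of_short {y : Fin n → K} (hy : y ∈ shortVectors K n) (i : Fin n) :
    ∃ k : ℤ, y i = k := by
  obtain ⟨j, s, hs, rfl⟩ := hy
  by_cases h : i = j
  · subst h
    rcases hs with rfl | rfl
    · exact ⟨1, by simp⟩
    · exact ⟨-1, by simp⟩
  · exact ⟨0, by simp [h]⟩

theorem exists_intCast_of_medium {y : Fin n → K} (hy : y ∈ mediumVectors K n) (i : Fin n) :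
    ∃ k : ℤ, y i = k := by
  obtain ⟨j, s, hs, l, -, t, ht, rfl⟩ := hy
  obtain ⟨a, ha⟩ := exists_intCast_of_short ⟨j, s, hs, rfl⟩ i
  obtain ⟨b, hb⟩ := exists_intCast_of_short ⟨l, t, ht, rfl⟩ i
  exact ⟨a + b, by rw [Pi.add_apply, ha, hb, Int.cast_add]⟩

theorem exists_intCast_of_long {y : Fin n → K} (hy : y ∈ longVectors K n) (i : Fin n) :
    ∃ k : ℤ, y i = ((2 * k : ℤ) : K) := by
  obtain ⟨j, s, hs, rfl⟩ := hy
  by_cases h : i = j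
  · subst h
    rcases hs with rfl | rfl
    · exact ⟨1, by simp⟩
    · exact ⟨-1, by simp⟩
  · exact ⟨0, by simp [h]⟩

theorem add_mem_progression {q r k : ℤ} {d : K} (hd : d ∈ progression K q r) :
    d + ((q * k : ℤ) : K) ∈ progression K q r := by
  obtain ⟨l, rfl⟩ := hd
  exact ⟨l + k, by push_cast; ring⟩

theorem layered_translate {p q r : ℤ} {e : (Fin n → K) → K}
    (h1 : ∀ y ∈ shortVectors K n, ∃ k : ℤ, e y = ((1 * k : ℤ) : K))
    (h2 : ∀ y ∈ mediumVectors K n, ∃ k : ℤ, e y = ((p * k : ℤ) : K))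
    (h3 : ∀ y ∈ longVectors K n, ∃ k : ℤ, e y = ((q * k : ℤ) : K)) {y : Fin n → K} {d : K}
    (h : (y, d) ∈ layered n (progression K 1 0) (progression K p 0) (progression K q r)) :
    (y, d + e y) ∈ layered n (progression K 1 0) (progression K p 0) (progression K q r) := by
  rcases h with ⟨hy, hd⟩ | ⟨hy, hd⟩ | ⟨hy, hd⟩
  · obtain ⟨k, hk⟩ := h1 y hy
    exact .inl ⟨hy, by rw [hk]; exact add_mem_progression hd⟩
  · obtain ⟨k, hk⟩ := h2 y hy
    exact .inr (.inl ⟨hy, by rw [hk]; exact add_mem_progression hd⟩)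
  · obtain ⟨k, hk⟩ := h3 y hy
    exact .inr (.inr ⟨hy, by rw [hk]; exact add_mem_progression hd⟩)

end Translations
-- Level sets of the five affine families.
section Families

variable {K : Type*} [Field K]

theorem zero_mem_progression {q : ℤ} : (0 : K) ∈ progression K q 0 := ⟨0, by simp⟩

theorem short_mem_realRoots {m : ℕ} {a₀ : (Fin (m + 1) → K) × K} {odd : Set (Fin (m + 2))} :
    (Pi.single (Fin.last m) 1, ((0 : ℤ) : K)) ∈
      {v | IsRealRoot (affineForm K (m + 1)) (affineSimpleRoots K (m + 1) a₀) odd v} := by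
  have := IsRealRoot.simple (B := affineForm K (m + 1)) (a := affineSimpleRoots K (m + 1) a₀)
    (odd := odd) (Fin.last (m + 1))
  rwa [affineSimpleRoots_last, ← Int.cast_zero] at this

theorem medium_mem_realRoots {m : ℕ} {a₀ : (Fin (m + 2) → K) × K} {odd : Set (Fin (m + 3))} :
    (Pi.single 0 1 + Pi.single 1 (-1), ((0 : ℤ) : K)) ∈
      {v | IsRealRoot (affineForm K (m + 2)) (affineSimpleRoots K (m + 2) a₀) odd v} := by
  have := IsRealRoot.simple (B := affineForm K (m + 2)) (a := affineSimpleRoots K (m + 2) a₀)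
    (odd := odd) (0 : Fin (m + 1)).castSucc.succ
  rwa [affineSimpleRoots_castSucc, ← Int.cast_zero] at this

theorem long_mem_realRoots {m : ℕ} {a₀ : (Fin (m + 1) → K) × K} {odd : Set (Fin (m + 2))}
    (h : Fin.last (m + 1) ∈ odd) :
    (Pi.single (Fin.last m) (2 * 1), ((0 : ℤ) : K)) ∈
      {v | IsRealRoot (affineForm K (m + 1)) (affineSimpleRoots K (m + 1) a₀) odd v} := by
  have := IsRealRoot.double (B := affineForm K (m + 1)) (a := affineSimpleRoots K (m + 1) a₀)
    (odd := odd) _ h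
  rw [affineSimpleRoots_last] at this
  simpa [Prod.smul_mk, ← Pi.single_smul] using this

theorem single_mem_short {n : ℕ} (i : Fin n) : Pi.single i 1 ∈ shortVectors K n :=
  ⟨i, 1, by simp, rfl⟩

theorem single_neg_mem_short {n : ℕ} (i : Fin n) : Pi.single i (-1) ∈ shortVectors K n :=
  ⟨i, -1, by simp, rfl⟩

theorem single_two_mem_long {n : ℕ} (i : Fin n) : Pi.single i (2 * 1) ∈ longVectors K n :=
  ⟨i, 1, by simp, rfl⟩

theorem single_neg_two_mem_long {n : ℕ} (i : Fin n) : Pi.single i (-2) ∈ longVectors K n :=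
  ⟨i, -1, by simp, by simp⟩

theorem add_single_mem_medium {n : ℕ} {i j : Fin n} (h : j ≠ i) {s t : K}
    (hs : s ∈ ({1, -1} : Set K)) (ht : t ∈ ({1, -1} : Set K)) :
    Pi.single i s + Pi.single j t ∈ mediumVectors K n :=
  ⟨i, s, hs, j, h, t, ht, rfl⟩

theorem exists_eq_succ_of_medium_nonempty {m : ℕ} (h : (mediumVectors K (m + 1)).Nonempty) : ∃ k, m = k + 1 := by
  obtain ⟨_, i, _, _, j, hij, _⟩ := h
  refine ⟨m - 1, ?_⟩
  have := Fin.val_ne_of_ne hij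
  omega

theorem smul_last_mem_layered {m : ℕ} {a₀ : (Fin (m + 1) → K) × K} {S M : Set K} {q : ℤ} :
    (2 : K) • affineSimpleRoots K (m + 1) a₀ (Fin.last (m + 1)) ∈
      layered (m + 1) S M (progression K q 0) := by
  rw [affineSimpleRoots_last]
  refine .inr (.inr ⟨⟨Fin.last m, 1, by simp, ?_⟩, ?_⟩)
  · simp [Prod.smul_mk, ← Pi.single_smul]
  · simpa using zero_mem_progression

theorem one_mem_signs : (1 : K) ∈ ({1, -1} : Set K) := .inl rfl

theorem neg_one_mem_signs : (-1 : K) ∈ ({1, -1} : Set K) := .inr rfl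

variable [CharZero K]

/-- Covers the four families with `α_0 = δ - a δ_1`, `a = 1` or `2`. The translation by `w y_0`, `w
= 2 / a`, moves the levels of `±δ_1` by `w`, of `δ_1 + δ_2` by `w` and of `2δ_1` by `2w`. Hence `hS`
and `hL` ask for a starting root in each residue class modulo `w` and `2w`; for medium roots `α_1`
at level `0` is enough. -/
theorem realRoots_eq_layered_of_single {m : ℕ} {a : K} {w q r : ℤ} (ha : a ≠ 0)
    (hw : 2 / a = w) (hq : q ∣ 2 * w) {odd : Set (Fin (m + 2))}
    (h0 : ((Pi.single 0 (-a), 1) : (Fin (m + 1) → K) × K) ∈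
      layered (m + 1) (progression K 1 0) (progression K w 0) (progression K q r))
    (hodd : ∀ i ∈ odd, (2 : K) • affineSimpleRoots K (m + 1) (Pi.single 0 (-a), 1) i ∈
      layered (m + 1) (progression K 1 0) (progression K w 0) (progression K q r))
    (hS : ∀ c ∈ progression K 1 0, ∃ k : ℤ, ∃ x ∈ shortVectors K (m + 1),
      IsRealRoot (affineForm K (m + 1)) (affineSimpleRoots K (m + 1) (Pi.single 0 (-a), 1)) odd
        (x, (k : K)) ∧ c ∈ progression K w k)
    (hL : ∀ c ∈ progression K q r, ∃ k : ℤ, ∃ x ∈ longVectors K (m + 1),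
      IsRealRoot (affineForm K (m + 1)) (affineSimpleRoots K (m + 1) (Pi.single 0 (-a), 1)) odd
        (x, (k : K)) ∧ c ∈ progression K (2 * w) k) :
    {v | IsRealRoot (affineForm K (m + 1)) (affineSimpleRoots K (m + 1) (Pi.single 0 (-a), 1)) odd
      v} = layered (m + 1) (progression K 1 0) (progression K w 0) (progression K q r) := by
  have hN := isSignedPermInvariant_layered (K := K) (n := m + 1) (progression K 1 0)
    (progression K w 0) (progression K q r)
  have hX := isSignedPermInvariant_realRoots (K := K) (a₀ := (Pi.single 0 (-a), 1)) (odd := odd)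
  have he : ∀ y : Fin (m + 1) → K, 2 * y 0 / a = w * y 0 := fun y => by rw [← hw]; ring
  refine subset_antisymm (realRoots_subset hN h0 ?_ (.inl ⟨single_mem_short _, ?_⟩)
    (fun i => .inr (.inl ⟨add_single_mem_medium i.castSucc_lt_succ.ne' (by simp) (by simp), ?_⟩))
    hodd) (hX.layered_subset ?_ ?_ ?_)
  · rintro ⟨y, d⟩ h
    rw [rootReflection_single_mem_iff hN 0 ha, he]
    refine layered_translate (e := fun y : Fin (m + 1) → K => w * y 0) (fun y hy => ?_) (fun y hy => ?_)
      (fun y hy => ?_) h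
    · obtain ⟨k, hk⟩ := exists_intCast_of_short hy 0
      exact ⟨w * k, by rw [hk]; push_cast; ring⟩
    · obtain ⟨k, hk⟩ := exists_intCast_of_medium hy 0
      exact ⟨k, by rw [hk]; push_cast; ring⟩
    · obtain ⟨k, hk⟩ := exists_intCast_of_long hy 0
      obtain ⟨l, hl⟩ := hq
      refine ⟨l * k, ?_⟩
      rw [hk, ← mul_assoc q, ← hl]; push_cast; ring
  · exact zero_mem_progression
  · exact zero_mem_progression
  all_goals
    have htr : ∀ y d, (y, d) ∈ {v | IsRealRoot (affineForm K (m + 1))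
        (affineSimpleRoots K (m + 1) (Pi.single 0 (-a), 1)) odd v} →
        (y, d + w * y 0) ∈ {v | IsRealRoot (affineForm K (m + 1))
        (affineSimpleRoots K (m + 1) (Pi.single 0 (-a), 1)) odd v} := fun y d h => by
      rw [← he, ← rootReflection_single_mem_iff hX 0 ha]
      exact IsRealRoot.reflect 0 _ h
  · intro c hc
    obtain ⟨k, x, hx, hr, hc⟩ := hS c hc
    refine exists_mem_of_mem_progression (e := fun y : Fin (m + 1) → K => w * y 0)
      (fun x hx y hy c => hX.mem_of_short hx hy) htr (single_mem_short 0) ?_ ?_ ?_ hx hr _ hc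
    · rw [← Pi.single_neg]; exact single_neg_mem_short 0
    · simp
    · simp
  · rintro hne c hc
    obtain ⟨k, rfl⟩ := exists_eq_succ_of_medium_nonempty hne
    have h10 : (1 : Fin (k + 2)) ≠ 0 := by simp
    refine exists_mem_of_mem_progression (e := fun y : Fin (k + 2) → K => w * y 0) (r := 0)
      (z := Pi.single 0 1 + Pi.single 1 1)
      (fun x hx y hy c => hX.mem_of_medium hx hy) htr
      (add_single_mem_medium h10 one_mem_signs one_mem_signs) ?_ ?_ ?_
      (add_single_mem_medium h10 one_mem_signs neg_one_mem_signs) medium_mem_realRoots _ hc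
    · rw [neg_add, ← Pi.single_neg, ← Pi.single_neg]
      exact add_single_mem_medium h10 neg_one_mem_signs neg_one_mem_signs
    · simp
    · simp
  · intro c hc
    obtain ⟨k, x, hx, hr, hc⟩ := hL c hc
    refine exists_mem_of_mem_progression (e := fun y : Fin (m + 1) → K => w * y 0)
      (fun x hx y hy c => hX.mem_of_long hx hy) htr (single_two_mem_long 0) ?_ ?_ ?_ hx hr _ hc
    · rw [← Pi.single_neg]; simpa using single_neg_two_mem_long 0
    · simp
    · simp [mul_comm]

theorem realRootsB0_eq_layered (m : ℕ) : realRootsB0 K (m + 1) =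
    layered (m + 1) (progression K 1 0) (progression K 1 0) (progression K 1 0) := by
  have h0 : -((2 : K) • deltaVec K (m + 1) 0) = Pi.single 0 (-2) := by
    rw [show deltaVec K (m + 1) 0 = Pi.single 0 1 from deltaVec_eq_single (0 : Fin (m + 1))]
    simp [← Pi.single_smul, ← Pi.single_neg]
  rw [realRootsB0, h0]
  refine realRoots_eq_layered_of_single two_ne_zero (by simp) (by simp)
    (.inr (.inr ⟨single_neg_two_mem_long 0, 1, by simp⟩)) ?_ ?_ ?_
  · rintro i rfl
    exact smul_last_mem_layered
  · exact fun c hc => ⟨0, _, single_mem_short _, short_mem_realRoots, hc⟩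
  · intro c hc
    -- Long levels move by `2`: the even ones start from `2α_n`, the odd ones from `α_0`.
    rcases mem_progression_cases hc with h | h
    · exact ⟨0, _, single_two_mem_long _, long_mem_realRoots rfl, h⟩
    · exact ⟨1, _, single_neg_two_mem_long 0, by
        rw [Int.cast_one]; exact IsRealRoot.simple 0, h⟩

theorem realRootsA2_eq_layered (m : ℕ) : realRootsA2 K (m + 1) =
    layered (m + 1) (progression K 1 0) (progression K 1 0) (progression K 2 1) := by
  have h0 : -((2 : K) • deltaVec K (m + 1) 0) = Pi.single 0 (-2) := by
    rw [show deltaVec K (m + 1) 0 = Pi.single 0 1 from deltaVec_eq_single (0 : Fin (m + 1))]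
    simp [← Pi.single_smul, ← Pi.single_neg]
  rw [realRootsA2, h0]
  refine realRoots_eq_layered_of_single two_ne_zero (by simp) (by simp)
    (.inr (.inr ⟨single_neg_two_mem_long 0, 0, by simp⟩)) (by simp) ?_ ?_
  · exact fun c hc => ⟨0, _, single_mem_short _, short_mem_realRoots, hc⟩
  · exact fun c hc => ⟨1, _, single_neg_two_mem_long 0, by
        rw [Int.cast_one]; exact IsRealRoot.simple 0, hc⟩

theorem realRootsC2_eq_layered (m : ℕ) : realRootsC2 K (m + 1) =
    layered (m + 1) (progression K 1 0) (progression K 2 0) (progression K 2 0) := by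
  have h0 : -deltaVec K (m + 1) 0 = Pi.single 0 (-1) := by
    rw [show deltaVec K (m + 1) 0 = Pi.single 0 1 from deltaVec_eq_single (0 : Fin (m + 1)),
      Pi.single_neg]
  have h2 : (2 : K) • affineSimpleRoots K (m + 1) (Pi.single 0 (-1), 1) 0 =
      (Pi.single 0 (-2), ((2 : ℤ) : K)) := by
    simp [affineSimpleRoots, Prod.smul_mk, ← Pi.single_smul]
  rw [realRootsC2, h0]
  refine realRoots_eq_layered_of_single one_ne_zero (by simp) (by simp)
    (.inl ⟨single_neg_mem_short 0, 1, by simp⟩) ?_ ?_ ?_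
  · rintro i (rfl | rfl)
    · rw [h2]
      exact .inr (.inr ⟨single_neg_two_mem_long 0, 1, by simp⟩)
    · exact smul_last_mem_layered
  · intro c hc
    -- Short levels move by `2`, starting from `α_n` and `α_0`. Long levels move by `4`, and below
    -- they start from `2α_n` at level `0` and `2α_0` at level `2`.
    rcases mem_progression_cases hc with h | h
    · exact ⟨0, _, single_mem_short _, short_mem_realRoots, h⟩
    · exact ⟨1, _, single_neg_mem_short 0, by
        rw [Int.cast_one]; exact IsRealRoot.simple 0, h⟩
  · intro c hc
    rcases mem_progression_cases hc with h | h
    · exact ⟨0, _, single_two_mem_long _, long_mem_realRoots (by simp), h⟩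
    · exact ⟨2, _, single_neg_two_mem_long 0, by
        rw [← h2]; exact IsRealRoot.double _ (by simp), h⟩

theorem realRootsA0even4_eq_layered (m : ℕ) : realRootsA0even4 K (m + 1) =
    layered (m + 1) (progression K 1 0) (progression K 2 0) (progression K 4 0) := by
  have h0 : -deltaVec K (m + 1) 0 = Pi.single 0 (-1) := by
    rw [show deltaVec K (m + 1) 0 = Pi.single 0 1 from deltaVec_eq_single (0 : Fin (m + 1)),
      Pi.single_neg]
  rw [realRootsA0even4, h0]
  refine realRoots_eq_layered_of_single one_ne_zero (by simp) (by simp)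
    (.inl ⟨single_neg_mem_short 0, 1, by simp⟩) ?_ ?_ ?_
  · rintro i rfl
    exact smul_last_mem_layered
  · intro c hc
    rcases mem_progression_cases hc with h | h
    · exact ⟨0, _, single_mem_short _, short_mem_realRoots, h⟩
    · exact ⟨1, _, single_neg_mem_short 0, by
        rw [Int.cast_one]; exact IsRealRoot.simple 0, h⟩
  · exact fun c hc => ⟨0, _, single_two_mem_long _, long_mem_realRoots rfl, hc⟩

/-- Here `α_0 = δ - δ_1 - δ_2` gives the translation by `y_0 + y_1`, which moves short levels by `1`
and long levels by `2`. -/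
theorem realRootsA0odd2_eq_layered (m : ℕ) : realRootsA0odd2 K (m + 2) =
    layered (m + 2) (progression K 1 0) (progression K 1 0) (progression K 2 0) := by
  have h0 : -deltaVec K (m + 2) 0 - deltaVec K (m + 2) 1 =
      Pi.single 0 (-1) + Pi.single 1 (-1) := by
    rw [show deltaVec K (m + 2) 0 = Pi.single 0 1 from deltaVec_eq_single (0 : Fin (m + 2)),
      show deltaVec K (m + 2) 1 = Pi.single 1 1 from deltaVec_eq_single (1 : Fin (m + 2)),
      Pi.single_neg, Pi.single_neg, sub_eq_add_neg]
  rw [realRootsA0odd2, h0]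
  have h10 : (1 : Fin (m + 2)) ≠ 0 := by simp
  have hN := isSignedPermInvariant_layered (K := K) (n := m + 2) (progression K 1 0)
    (progression K 1 0) (progression K 2 0)
  have hX := isSignedPermInvariant_realRoots (K := K) (m := m + 1)
    (a₀ := (Pi.single 0 (-1) + Pi.single 1 (-1), 1)) (odd := {Fin.last (m + 2)})
  refine subset_antisymm (realRoots_subset hN
    (.inr (.inl ⟨add_single_mem_medium h10 (by simp) (by simp), 1, by simp⟩)) ?_
    (.inl ⟨single_mem_short _, ?_⟩)
    (fun i => .inr (.inl ⟨add_single_mem_medium i.castSucc_lt_succ.ne' (by simp) (by simp), ?_⟩))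
    ?_) (hX.layered_subset ?_ ?_ ?_)
  · rintro ⟨y, d⟩ h
    rw [rootReflection_neg_sub_single_mem_iff hN h10]
    refine layered_translate (e := fun y => y 0 + y 1) (fun y hy => ?_) (fun y hy => ?_)
      (fun y hy => ?_) h
    · obtain ⟨k, hk⟩ := exists_intCast_of_short hy 0
      obtain ⟨l, hl⟩ := exists_intCast_of_short hy 1
      exact ⟨k + l, by rw [hk, hl]; push_cast; ring⟩
    · obtain ⟨k, hk⟩ := exists_intCast_of_medium hy 0
      obtain ⟨l, hl⟩ := exists_intCast_of_medium hy 1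
      exact ⟨k + l, by rw [hk, hl]; push_cast; ring⟩
    · obtain ⟨k, hk⟩ := exists_intCast_of_long hy 0
      obtain ⟨l, hl⟩ := exists_intCast_of_long hy 1
      exact ⟨k + l, by rw [hk, hl]; push_cast; ring⟩
  · exact zero_mem_progression
  · exact zero_mem_progression
  · rintro i rfl
    exact smul_last_mem_layered
  all_goals
    have htr : ∀ y d, (y, d) ∈ {v | IsRealRoot (affineForm K (m + 2))
        (affineSimpleRoots K (m + 2) (Pi.single 0 (-1) + Pi.single 1 (-1), 1))
        {Fin.last (m + 2)} v} →
        (y, d + (y 0 + y 1)) ∈ {v | IsRealRoot (affineForm K (m + 2))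
        (affineSimpleRoots K (m + 2) (Pi.single 0 (-1) + Pi.single 1 (-1), 1))
        {Fin.last (m + 2)} v} := fun y d h => by
      rw [← rootReflection_neg_sub_single_mem_iff hX h10]
      exact IsRealRoot.reflect 0 _ h
  · intro c hc
    refine exists_mem_of_mem_progression (e := fun y => y 0 + y 1) (r := 0)
      (fun x hx y hy c => hX.mem_of_short hx hy) htr (single_mem_short 0) ?_ ?_ ?_
      (single_mem_short _) short_mem_realRoots _ hc
    · rw [← Pi.single_neg]; exact single_neg_mem_short 0
    · simp
    · simp
  · rintro - c hc
    -- The vector `δ_1 + δ_2` is translated by `2`, so the two parities need separate starting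
    -- roots: `α_1` at level `0` and `α_0` at level `1`.
    have key : ∀ k : ℤ, ∀ x ∈ mediumVectors K (m + 2),
        IsRealRoot (affineForm K (m + 2))
          (affineSimpleRoots K (m + 2) (Pi.single 0 (-1) + Pi.single 1 (-1), 1))
          {Fin.last (m + 2)} (x, (k : K)) → ∀ c ∈ progression K 2 k,
        ∃ x ∈ mediumVectors K (m + 2), (x, c) ∈ {v | IsRealRoot (affineForm K (m + 2))
          (affineSimpleRoots K (m + 2) (Pi.single 0 (-1) + Pi.single 1 (-1), 1))
          {Fin.last (m + 2)} v} := by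
      intro k x hx hr
      refine exists_mem_of_mem_progression (e := fun y => y 0 + y 1)
        (z := Pi.single 0 1 + Pi.single 1 1)
        (fun x hx y hy c => hX.mem_of_medium hx hy) htr
        (add_single_mem_medium h10 one_mem_signs one_mem_signs) ?_ ?_ ?_ hx hr
      · rw [neg_add, ← Pi.single_neg, ← Pi.single_neg]
        exact add_single_mem_medium h10 neg_one_mem_signs neg_one_mem_signs
      · simp
      · simp; norm_num
    rcases mem_progression_cases hc with h | h
    · exact key 0 _ (add_single_mem_medium h10 one_mem_signs neg_one_mem_signs) medium_mem_realRoots c h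
    · refine key 1 _ (add_single_mem_medium h10 neg_one_mem_signs neg_one_mem_signs) ?_ c h
      rw [Int.cast_one]
      exact IsRealRoot.simple 0
  · intro c hc
    refine exists_mem_of_mem_progression (e := fun y => y 0 + y 1) (r := 0)
      (fun x hx y hy c => hX.mem_of_long hx hy) htr (single_two_mem_long 0) ?_ ?_ ?_
      (single_two_mem_long _) (long_mem_realRoots rfl) _ hc
    · rw [← Pi.single_neg]; simpa using single_neg_two_mem_long 0
    · simp
    · simp

end Families

/-! ### Arithmetic of sets closed under `y ↦ y - 2x`. -/

/-- The generator is `k d` with `k` the least positive integer such that `k d ∈ S`. -/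
theorem exists_eq_zmultiples {K : Type*} [Field K] {S : Set K} (h0 : 0 ∈ S)
    (h2 : ∀ x ∈ S, ∀ y ∈ S, y - 2 * x ∈ S) {d : K} (hd : ∀ c ∈ S, ∃ k : ℤ, c = k * d) :
    ∃ s : K, ∀ c, c ∈ S ↔ ∃ k : ℤ, c = k * s := by
  classical
  have hneg : ∀ x ∈ S, -x ∈ S := fun x hx => by
    have := h2 x hx x hx
    rwa [show x - 2 * x = -x by ring] at this
  by_cases hS : ∀ c ∈ S, c = 0
  · exact ⟨0, fun c => ⟨fun h => ⟨0, by simp [hS c h]⟩, by rintro ⟨k, rfl⟩; simpa using h0⟩⟩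
  push Not at hS
  obtain ⟨c, hc, hc0⟩ := hS
  have hex : ∃ k : ℕ, 0 < k ∧ (k : K) * d ∈ S := by
    obtain ⟨k, rfl⟩ := hd c hc
    obtain ⟨l, rfl | rfl⟩ := k.eq_nat_or_neg
    · exact ⟨l, Nat.pos_of_ne_zero fun h => hc0 (by simp [h]), by simpa using hc⟩
    · exact ⟨l, Nat.pos_of_ne_zero fun h => hc0 (by simp [h]), by simpa using hneg _ hc⟩
  obtain ⟨k, ⟨hk, hks⟩, hmin⟩ : ∃ k : ℕ, (0 < k ∧ (k : K) * d ∈ S) ∧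
      ∀ l : ℕ, 0 < l → (l : K) * d ∈ S → k ≤ l :=
    ⟨Nat.find hex, Nat.find_spec hex, fun l h h' => Nat.find_min' hex ⟨h, h'⟩⟩
  -- Closure only permits shifts by `2 k d`, so even and odd multiples are reached separately, from
  -- `0` and from `k d`.
  have hmem : ∀ j : ℤ, (2 * j : K) * (k * d) ∈ S ∧ (2 * j + 1 : K) * (k * d) ∈ S := by
    intro j
    induction j using Int.induction_on with
    | zero => exact ⟨by simpa using h0, by simpa using hks⟩
    | succ j ih =>
      refine ⟨?_, ?_⟩
      · convert h2 _ (hneg _ hks) _ ih.1 using 1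
        push_cast; ring
      · convert h2 _ (hneg _ hks) _ ih.2 using 1
        push_cast; ring
    | pred j ih =>
      refine ⟨?_, ?_⟩
      · convert h2 _ hks _ ih.1 using 1
        push_cast; ring
      · convert h2 _ hks _ ih.2 using 1
        push_cast; ring
  have hmem' : ∀ j : ℤ, (j : K) * (k * d) ∈ S := by
    intro j
    obtain ⟨l, rfl | rfl⟩ := j.even_or_odd'
    · simpa using (hmem l).1
    · simpa using (hmem l).2
  refine ⟨k * d, fun c => ⟨fun hc => ?_, by rintro ⟨j, rfl⟩; exact hmem' j⟩⟩
  obtain ⟨l, rfl⟩ := hd c hc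
  -- For the same reason the division is by `2k`. If the remainder `r` is not `0`, then both `r d`
  -- and `(2k - r) d` lie in `S`, and minimality gives `k ≤ r` and `k ≤ 2k - r`, so `r = k`.
  have hl := Int.mul_ediv_add_emod l (2 * k)
  set q := l / (2 * (k : ℤ))
  have hr0 : 0 ≤ l % (2 * (k : ℤ)) := Int.emod_nonneg _ (by omega)
  have hr1 : l % (2 * (k : ℤ)) < 2 * (k : ℤ) := Int.emod_lt_of_pos _ (by omega)
  obtain ⟨r, hr⟩ := Int.eq_ofNat_of_zero_le hr0
  rw [hr] at hl hr1
  have hrS : (r : K) * d ∈ S := by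
    convert h2 _ (hmem' q) _ hc using 1
    rw [← hl]; push_cast; ring
  rcases Nat.eq_zero_or_pos r with rfl | hrpos
  · exact ⟨2 * q, by rw [← hl]; push_cast; ring⟩
  have hkr := hmin r hrpos hrS
  have hrS' : ((2 * k - r : ℕ) : K) * d ∈ S := by
    convert hneg _ (h2 _ hks _ hrS) using 1
    rw [Nat.cast_sub (by omega)]; push_cast; ring
  have hkr' := hmin (2 * k - r) (by omega) hrS'
  obtain rfl : r = k := by omega
  exact ⟨2 * q + 1, by rw [← hl]; push_cast; ring⟩

/-- Only residues modulo `4` matter. Taking `x = y` gives symmetry, so `1` and `3` occur together;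
if `1` occurs, reflecting in it exchanges `0` and `2`. Five nonempty sets of residues remain. -/
theorem forall_iff_dvd_of_sub_four_mul {P : ℤ → Prop} (h : ∃ k, P k)
    (h4 : ∀ k j, P k → P (k - 4 * j)) (h2 : ∀ x y, P x → P y → P (y - 2 * x)) :
    (∀ k, P k ↔ (1 : ℤ) ∣ k - 0) ∨ (∀ k, P k ↔ (2 : ℤ) ∣ k - 0) ∨ (∀ k, P k ↔ (2 : ℤ) ∣ k - 1) ∨
      (∀ k, P k ↔ (4 : ℤ) ∣ k - 0) ∨ (∀ k, P k ↔ (4 : ℤ) ∣ k - 2) := by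
  have hmod : ∀ k l, k % 4 = l % 4 → P k → P l := fun k l hkl hk => by
    have := h4 k ((k - l) / 4) hk
    rwa [show k - 4 * ((k - l) / 4) = l by omega] at this
  have hmod' : ∀ k l, k % 4 = l % 4 → (P k ↔ P l) := fun k l hkl =>
    ⟨hmod k l hkl, hmod l k hkl.symm⟩
  have h13 : P 1 ↔ P 3 :=
    ⟨fun h => hmod (1 - 2 * 1) 3 (by norm_num) (h2 1 1 h h),
      fun h => hmod (3 - 2 * 3) 1 (by norm_num) (h2 3 3 h h)⟩
  have h102 : P 1 → (P 0 ↔ P 2) := fun h =>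
    ⟨fun h' => hmod (0 - 2 * 1) 2 (by norm_num) (h2 1 0 h h'),
      fun h' => hmod (2 - 2 * 1) 0 (by norm_num) (h2 1 2 h h')⟩
  have hex : P 0 ∨ P 1 ∨ P 2 := by
    obtain ⟨k, hk⟩ := h
    have : k % 4 = 0 ∨ k % 4 = 1 ∨ k % 4 = 2 ∨ k % 4 = 3 := by omega
    rcases this with h | h | h | h
    · exact .inl (hmod k 0 (by omega) hk)
    · exact .inr (.inl (hmod k 1 (by omega) hk))
    · exact .inr (.inr (hmod k 2 (by omega) hk))
    · exact .inr (.inl (h13.2 (hmod k 3 (by omega) hk)))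
  have key : ∀ Q : ℤ → Prop, (∀ k l, k % 4 = l % 4 → (Q k ↔ Q l)) → (P 0 ↔ Q 0) → (P 1 ↔ Q 1) →
      (P 2 ↔ Q 2) → (P 3 ↔ Q 3) → ∀ k, P k ↔ Q k := by
    intro Q hQ q0 q1 q2 q3 k
    have : k % 4 = 0 ∨ k % 4 = 1 ∨ k % 4 = 2 ∨ k % 4 = 3 := by omega
    rcases this with h | h | h | h
    · rw [hmod' k 0 (by omega), hQ k 0 (by omega), q0]
    · rw [hmod' k 1 (by omega), hQ k 1 (by omega), q1]
    · rw [hmod' k 2 (by omega), hQ k 2 (by omega), q2]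
    · rw [hmod' k 3 (by omega), hQ k 3 (by omega), q3]
  by_cases p1 : P 1
  · have p3 := h13.1 p1
    by_cases p0 : P 0
    · have p2 := (h102 p1).1 p0
      refine .inl (key _ (fun k l h => by omega) ?_ ?_ ?_ ?_) <;> simp [p0, p1, p2, p3]
    · have p2 : ¬P 2 := fun h => p0 ((h102 p1).2 h)
      refine .inr (.inr (.inl (key _ (fun k l h => by omega) ?_ ?_ ?_ ?_))) <;>
        simp only [p0, p1, p2, p3, true_iff, false_iff] <;> decide
  · have p3 : ¬P 3 := fun h => p1 (h13.2 h)
    by_cases p0 : P 0 <;> by_cases p2 : P 2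
    · refine .inr (.inl (key _ (fun k l h => by omega) ?_ ?_ ?_ ?_)) <;>
        simp only [p0, p1, p2, p3, true_iff, false_iff] <;> decide
    · refine .inr (.inr (.inr (.inl (key _ (fun k l h => by omega) ?_ ?_ ?_ ?_)))) <;>
        simp only [p0, p1, p2, p3, true_iff, false_iff] <;> decide
    · refine .inr (.inr (.inr (.inr (key _ (fun k l h => by omega) ?_ ?_ ?_ ?_)))) <;>
        simp only [p0, p1, p2, p3, true_iff, false_iff] <;> decide
    · exact absurd hex (by tauto)

/-! ### Classification of normalized systems. -/

/-- A system of affine type over `B(0,n)` in which `δ_1` and the `δ_i - δ_1` are roots. -/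
structure IsNormalizedSystem {K : Type*} [Field K] {m : ℕ} (X : Set ((Fin (m + 1) → K) × K)) :
    Prop where
  fst_mem : ∀ p ∈ X, p.1 ∈ rootsB0 K (m + 1)
  exists_mem : ∀ x ∈ rootsB0 K (m + 1), ∃ c, (x, c) ∈ X
  reflection : ∀ p ∈ X, ∀ q ∈ X, rootReflection (affineForm K (m + 1)) p q ∈ X
  discrete : ∃ d : K, ∀ c, (Pi.single 0 1, c) ∈ X → ∃ k : ℤ, c = k * d
  exists_snd_ne_zero : ∃ p ∈ X, p.2 ≠ 0
  single_mem : (Pi.single 0 1, 0) ∈ X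
  sub_single_mem : ∀ i ≠ 0, (Pi.single i 1 + Pi.single 0 (-1), 0) ∈ X

namespace IsNormalizedSystem

variable {K : Type*} [Field K] [CharZero K] {m : ℕ} {X : Set ((Fin (m + 1) → K) × K)}

/-- The level-`0` roots `δ_i - δ_1` act as transpositions with the index `0`, which generate all
permutations, and `δ_1` supplies a sign change. -/
theorem isSignedPermInvariant (hX : IsNormalizedSystem X) : IsSignedPermInvariant X := by
  have h0 : ∀ i, i ≠ 0 → ∀ (y : Fin (m + 1) → K) (c : K), (y, c) ∈ X →
      (y ∘ Equiv.swap i 0, c) ∈ X := fun i hi y c h => by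
    have := hX.reflection _ (hX.sub_single_mem i hi) _ h
    rwa [rootReflection_sub_single hi.symm, mul_zero, sub_zero] at this
  have h1 : ∀ i j, i ≠ j → ∀ (y : Fin (m + 1) → K) (c : K), (y, c) ∈ X →
      (y ∘ Equiv.swap i j, c) ∈ X := by
    intro i j hij y c h
    by_cases hj : j = 0
    · subst hj; exact h0 i hij y c h
    by_cases hi : i = 0
    · subst hi; rw [Equiv.swap_comm]; exact h0 j hj y c h
    rw [← Equiv.swap_mul_swap_mul_swap (x := j) (y := 0) (z := i) hj hij.symm, Equiv.swap_comm 0 i]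
    exact h0 i hi _ c (h0 j hj _ c (h0 i hi y c h))
  have hperm : ∀ (σ : Equiv.Perm (Fin (m + 1))) (y : Fin (m + 1) → K) (c : K),
      (y, c) ∈ X → (y ∘ σ, c) ∈ X := by
    intro σ
    induction σ using Equiv.Perm.swap_induction_on with
    | one => exact fun y c h => h
    | swap_mul σ i j hij ih => exact fun y c h => ih _ c (h1 i j hij _ _ h)
  refine ⟨hperm, fun i y c h => ?_⟩
  have h2 := hX.reflection _ hX.single_mem _ (hperm (Equiv.swap i 0) _ _ h)
  rw [rootReflection_single _ one_ne_zero, mul_zero, sub_zero] at h2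
  convert hperm (Equiv.swap i 0) _ _ h2 using 2
  ext k
  by_cases hk : k = i
  · subst hk; simp
  · have : Equiv.swap i 0 k ≠ 0 := fun h => hk
      ((Equiv.swap i 0).injective (by rw [h, Equiv.swap_apply_left]))
    simp [hk, this]

/-- This and the next lemmas each apply one reflection and then a signed permutation or a negation
of the level. They give `S - 2S ⊆ S`, `L - 2L ⊆ L`, `L - 4S ⊆ L`, `L ⊆ S`, `M ⊆ S`, `M - 2S ⊆ M`, `L
⊆ M` and `L + 2M ⊆ L`. -/
theorem short_sub (hX : IsNormalizedSystem X) {x y : K} (hx : (Pi.single 0 1, x) ∈ X)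
    (hy : (Pi.single 0 1, y) ∈ X) : (Pi.single 0 1, y - 2 * x) ∈ X := by
  have := hX.reflection _ hx _ hy
  rw [rootReflection_single _ one_ne_zero] at this
  simpa using hX.isSignedPermInvariant.of_flip this

theorem short_neg (hX : IsNormalizedSystem X) {x : K} (hx : (Pi.single 0 1, x) ∈ X) :
    (Pi.single 0 1, -x) ∈ X := by
  have := hX.short_sub hx hx
  rwa [show x - 2 * x = -x by ring] at this

theorem long_sub (hX : IsNormalizedSystem X) {x y : K} (hx : (Pi.single 0 (2 * 1), x) ∈ X)
    (hy : (Pi.single 0 (2 * 1), y) ∈ X) : (Pi.single 0 (2 * 1), y - 2 * x) ∈ X := by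
  have := hX.reflection _ hx _ hy
  rw [rootReflection_single _ (by simp)] at this
  simpa using hX.isSignedPermInvariant.of_flip this

theorem long_sub_short (hX : IsNormalizedSystem X) {x y : K} (hx : (Pi.single 0 1, x) ∈ X)
    (hy : (Pi.single 0 (2 * 1), y) ∈ X) : (Pi.single 0 (2 * 1), y - 4 * x) ∈ X := by
  have := hX.reflection _ hx _ hy
  rw [rootReflection_single _ (by simp)] at this
  have := hX.isSignedPermInvariant.of_flip this
  convert this using 2
  simp
  norm_num

theorem short_of_long (hX : IsNormalizedSystem X) {x : K} (hx : (Pi.single 0 (2 * 1), x) ∈ X) :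
    (Pi.single 0 1, x) ∈ X := by
  have := hX.reflection _ hx _ hX.single_mem
  rw [rootReflection_single _ (by simp)] at this
  have := hX.short_neg (hX.isSignedPermInvariant.of_flip this)
  simpa using this

theorem short_of_medium (hX : IsNormalizedSystem X) {i : Fin (m + 1)} (hi : i ≠ 0) {x : K}
    (hx : (Pi.single i 1 + Pi.single 0 (-1), x) ∈ X) : (Pi.single 0 1, x) ∈ X := by
  have := hX.reflection _ hx _ hX.single_mem
  rw [rootReflection_sub_single hi.symm] at this
  refine hX.isSignedPermInvariant.mem_of_short (x := Pi.single i 1) (single_mem_short i)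
    (single_mem_short 0) ?_
  simpa [single_comp_perm, hi] using this

theorem medium_sub_short (hX : IsNormalizedSystem X) {i : Fin (m + 1)} (hi : i ≠ 0) {x y : K}
    (hx : (Pi.single 0 1, x) ∈ X) (hy : (Pi.single i 1 + Pi.single 0 (-1), y) ∈ X) :
    (Pi.single i 1 + Pi.single 0 (-1), y - 2 * x) ∈ X := by
  have := hX.reflection _ (hX.short_neg hx) _ hy
  rw [rootReflection_single _ (by simp)] at this
  have := hX.isSignedPermInvariant.of_flip this
  simpa [hi.symm] using this

theorem medium_of_long (hX : IsNormalizedSystem X) {i : Fin (m + 1)} (hi : i ≠ 0) {x : K}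
    (hx : (Pi.single 0 (2 * 1), x) ∈ X) : (Pi.single i 1 + Pi.single 0 (-1), x) ∈ X := by
  have := hX.reflection _ hx _ (hX.sub_single_mem i hi)
  rw [rootReflection_single _ (by simp)] at this
  have := hX.isSignedPermInvariant.of_flip this
  simpa [hi.symm] using this

theorem long_sub_medium (hX : IsNormalizedSystem X) {i : Fin (m + 1)} (hi : i ≠ 0) {x y : K}
    (hx : (Pi.single i 1 + Pi.single 0 (-1), x) ∈ X) (hy : (Pi.single 0 (2 * 1), y) ∈ X) :
    (Pi.single 0 (2 * 1), y + 2 * x) ∈ X := by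
  have := hX.reflection _ hx _ hy
  rw [rootReflection_sub_single hi.symm] at this
  refine hX.isSignedPermInvariant.mem_of_long (x := Pi.single i (2 * 1)) (single_two_mem_long i)
    (single_two_mem_long 0) ?_
  simpa [single_comp_perm, hi] using this

/-- The generator of `S` is nonzero because every level of a root lies in `S` and some root has
nonzero level. -/
theorem exists_short_eq (hX : IsNormalizedSystem X) :
    ∃ s : K, s ≠ 0 ∧ ∀ c, (Pi.single 0 1, s * c) ∈ X ↔ ∃ k : ℤ, c = k := by
  obtain ⟨d, hd⟩ := hX.discrete
  obtain ⟨s, hs⟩ := exists_eq_zmultiples (S := {c | (Pi.single 0 1, c) ∈ X}) hX.single_mem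
    (fun x hx y hy => hX.short_sub hx hy) hd
  have hs0 : s ≠ 0 := by
    rintro rfl
    obtain ⟨⟨x, c⟩, hp, hc⟩ := hX.exists_snd_ne_zero
    refine hc ?_
    have h : (Pi.single 0 1, c) ∈ X := by
      rcases mem_rootsB0_iff.1 (hX.fst_mem _ hp) with h | h | h
      · exact hX.isSignedPermInvariant.mem_of_short h (single_mem_short 0) hp
      · obtain ⟨k, rfl⟩ := exists_eq_succ_of_medium_nonempty ⟨_, h⟩
        have h10 : (1 : Fin (k + 2)) ≠ 0 := by simp
        exact hX.short_of_medium h10 (hX.isSignedPermInvariant.mem_of_medium h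
          (add_single_mem_medium h10.symm one_mem_signs neg_one_mem_signs) hp)
      · exact hX.short_of_long (hX.isSignedPermInvariant.mem_of_long h (single_two_mem_long 0) hp)
    obtain ⟨k, hk⟩ := (hs c).1 h
    simpa using hk
  refine ⟨s, hs0, fun c => (hs _).trans (exists_congr fun k => ?_)⟩
  rw [mul_comm, mul_left_inj' hs0]

theorem mem_iff_mem_layered (hX : IsNormalizedSystem X) {s : K}
    (hs : ∀ c, (Pi.single 0 1, s * c) ∈ X ↔ ∃ k : ℤ, c = k) {p q r : ℤ}
    (hM : ∀ i : Fin (m + 1), i ≠ 0 → ∀ c,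
      (Pi.single i 1 + Pi.single 0 (-1), s * c) ∈ X ↔ c ∈ progression K p 0)
    (hL : ∀ c, (Pi.single 0 (2 * 1), s * c) ∈ X ↔ c ∈ progression K q r)
    (x : Fin (m + 1) → K) (c : K) : (x, s * c) ∈ X ↔
      (x, c) ∈ layered (m + 1) (progression K 1 0) (progression K p 0) (progression K q r) := by
  have hI := hX.isSignedPermInvariant
  have hs' : ∀ c, (Pi.single 0 1, s * c) ∈ X ↔ c ∈ progression K 1 0 := fun c => by
    rw [hs]; simp [progression]
  have hm : x ∈ mediumVectors K (m + 1) → ((x, s * c) ∈ X ↔ c ∈ progression K p 0) := fun hx => by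
    obtain ⟨k, rfl⟩ := exists_eq_succ_of_medium_nonempty ⟨_, hx⟩
    have h10 : (1 : Fin (k + 2)) ≠ 0 := by simp
    have hmed := add_single_mem_medium (K := K) h10.symm one_mem_signs neg_one_mem_signs
    rw [← hM 1 h10]
    exact ⟨hI.mem_of_medium hx hmed, hI.mem_of_medium hmed hx⟩
  constructor
  · intro h
    rcases mem_rootsB0_iff.1 (hX.fst_mem _ h) with hx | hx | hx
    · exact .inl ⟨hx, (hs' c).1 (hI.mem_of_short hx (single_mem_short 0) h)⟩
    · exact .inr (.inl ⟨hx, (hm hx).1 h⟩)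
    · exact .inr (.inr ⟨hx, (hL c).1 (hI.mem_of_long hx (single_two_mem_long 0) h)⟩)
  · rintro (⟨hx, h⟩ | ⟨hx, h⟩ | ⟨hx, h⟩)
    · exact hI.mem_of_short (single_mem_short 0) hx ((hs' c).2 h)
    · exact (hm hx).2 h
    · exact hI.mem_of_long (single_two_mem_long 0) hx ((hL c).2 h)

theorem exists_mem_iff_mem_layered (hX : IsNormalizedSystem X) :
    ∃ s : K, s ≠ 0 ∧ ∃ p q r : ℤ, (∀ x c, (x, s * c) ∈ X ↔
      (x, c) ∈ layered (m + 1) (progression K 1 0) (progression K p 0) (progression K q r)) ∧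
      ((p = 1 ∧ q = 1 ∧ r = 0) ∨ (p = 2 ∧ q = 2 ∧ r = 0) ∨ (p = 1 ∧ q = 2 ∧ r = 1) ∨
        (1 ≤ m ∧ p = 1 ∧ q = 2 ∧ r = 0) ∨ (p = 2 ∧ q = 4 ∧ r = 0) ∨
        (p = 2 ∧ q = 4 ∧ r = 2)) := by
  obtain ⟨s, hs0, hs⟩ := hX.exists_short_eq
  have hsc : ∀ k : ℤ, (Pi.single 0 1, s * k) ∈ X := fun k => (hs k).2 ⟨k, rfl⟩
  -- Medium and long levels are also short levels, hence integers after scaling by `s`, so testing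
  -- integers is enough.
  have lift : ∀ (v : Fin (m + 1) → K) (a b : ℤ),
      (∀ c, (v, s * c) ∈ X → (Pi.single 0 1, s * c) ∈ X) →
      (∀ k : ℤ, (v, s * (k : K)) ∈ X ↔ a ∣ k - b) →
      ∀ c, (v, s * c) ∈ X ↔ c ∈ progression K a b := by
    intro v a b h1 h2 c
    constructor
    · intro h
      obtain ⟨k, rfl⟩ := (hs c).1 (h1 c h)
      exact intCast_mem_progression.2 ((h2 k).1 h)
    · intro h
      obtain ⟨k, rfl⟩ := exists_intCast_eq h
      exact (h2 k).2 (intCast_mem_progression.1 h)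
  have liftL := fun a b => lift (Pi.single 0 (2 * 1)) a b (fun c => hX.short_of_long)
  have hL := forall_iff_dvd_of_sub_four_mul (P := fun k => (Pi.single 0 (2 * 1), s * (k : K)) ∈ X)
    (by
      obtain ⟨c, hc⟩ := hX.exists_mem (Pi.single 0 (2 * 1))
        (mem_rootsB0_iff.2 (.inr (.inr (single_two_mem_long 0))))
      obtain ⟨k, hk⟩ := (hs (s⁻¹ * c)).1 (by rw [mul_inv_cancel_left₀ hs0]; exact hX.short_of_long hc)
      exact ⟨k, by rwa [← hk, mul_inv_cancel_left₀ hs0]⟩)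
    (fun k j h => by
      convert hX.long_sub_short (hsc j) h using 2
      push_cast; ring)
    (fun x y hx hy => by
      convert hX.long_sub hx hy using 2
      push_cast; ring)
  refine ⟨s, hs0, ?_⟩
  by_cases hm : m = 0
  · subst hm
    -- For `n = 1` there are no medium vectors, so `p` is free; below it is chosen to fit the table.
    have key := fun p q r => hX.mem_iff_mem_layered hs (p := p) (q := q) (r := r)
      (fun i hi => absurd (Subsingleton.elim (α := Fin 1) i 0) hi)
    rcases hL with h | h | h | h | h
    · exact ⟨1, 1, 0, key _ _ _ (liftL _ _ h), by simp⟩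
    · exact ⟨2, 2, 0, key _ _ _ (liftL _ _ h), by simp⟩
    · exact ⟨1, 2, 1, key _ _ _ (liftL _ _ h), by simp⟩
    · exact ⟨2, 4, 0, key _ _ _ (liftL _ _ h), by simp⟩
    · exact ⟨2, 4, 2, key _ _ _ (liftL _ _ h), by simp⟩
  obtain ⟨m, rfl⟩ := Nat.exists_eq_succ_of_ne_zero hm
  have hm1 : 1 ≤ m + 1 := by omega
  have h10 : (1 : Fin (m + 2)) ≠ 0 := by simp
  have hmed : ∀ i : Fin (m + 2), i ≠ 0 → ∀ c : K,
      ((Pi.single i 1 + Pi.single 0 (-1), c) ∈ X ↔ (Pi.single 1 1 + Pi.single 0 (-1), c) ∈ X) := by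
    intro i hi c
    have h1 := add_single_mem_medium (K := K) hi.symm one_mem_signs neg_one_mem_signs
    have h2 := add_single_mem_medium (K := K) h10.symm one_mem_signs neg_one_mem_signs
    exact ⟨hX.isSignedPermInvariant.mem_of_medium h1 h2,
      hX.isSignedPermInvariant.mem_of_medium h2 h1⟩
  have key := fun p q r h => hX.mem_iff_mem_layered hs (p := p) (q := q) (r := r)
    (fun i hi c => (hmed i hi _).trans (lift _ _ _ (fun c => hX.short_of_medium h10) h c))
  have hM0 : (Pi.single 1 1 + Pi.single 0 (-1), s * ((0 : ℤ) : K)) ∈ X := by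
    simpa using hX.sub_single_mem 1 h10
  have hM2 : ∀ k j : ℤ, (Pi.single 1 1 + Pi.single 0 (-1), s * (k : K)) ∈ X →
      (Pi.single 1 1 + Pi.single 0 (-1), s * ((k - 2 * j : ℤ) : K)) ∈ X := fun k j h => by
    convert hX.medium_sub_short h10 (hsc j) h using 2
    push_cast; ring
  -- `M` contains `0` and is invariant under `2ℤ`, so it is `ℤ` or `2ℤ` according to whether it
  -- contains `1`.
  by_cases hM1 : (Pi.single 1 1 + Pi.single 0 (-1), s * ((1 : ℤ) : K)) ∈ X
  · have hM : ∀ k : ℤ, (Pi.single 1 1 + Pi.single 0 (-1), s * (k : K)) ∈ X ↔ (1 : ℤ) ∣ k - 0 := by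
      intro k
      refine iff_of_true ?_ (one_dvd _)
      obtain ⟨j, rfl | rfl⟩ := k.even_or_odd'
      · simpa using hM2 0 (-j) hM0
      · have := hM2 1 (-j) hM1
        rwa [show (1 : ℤ) - 2 * -j = 2 * j + 1 by ring] at this
    -- With `1 ∈ M`, `L + 2M ⊆ L` excludes the two sets of period `4`.
    have hL2 : ∀ k : ℤ, (Pi.single 0 (2 * 1), s * (k : K)) ∈ X →
        (Pi.single 0 (2 * 1), s * ((k + 2 : ℤ) : K)) ∈ X := fun k h => by
      convert hX.long_sub_medium h10 hM1 h using 2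
      push_cast; ring
    rcases hL with h | h | h | h | h
    · exact ⟨1, 1, 0, key _ _ _ hM (liftL _ _ h), by simp⟩
    · exact ⟨1, 2, 0, key _ _ _ hM (liftL _ _ h), by simp⟩
    · exact ⟨1, 2, 1, key _ _ _ hM (liftL _ _ h), by simp⟩
    · exact absurd ((h _).1 (hL2 0 ((h 0).2 (by decide)))) (by decide)
    · exact absurd ((h _).1 (hL2 2 ((h 2).2 (by decide)))) (by decide)
  · have hM : ∀ k : ℤ, (Pi.single 1 1 + Pi.single 0 (-1), s * (k : K)) ∈ X ↔ (2 : ℤ) ∣ k - 0 := by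
      intro k
      obtain ⟨j, rfl | rfl⟩ := k.even_or_odd'
      · exact iff_of_true (by simpa using hM2 0 (-j) hM0) (by simp)
      · refine iff_of_false (fun h => hM1 ?_) (by omega)
        have := hM2 _ j h
        rwa [show 2 * j + 1 - 2 * j = 1 by ring] at this
    -- With `M = 2ℤ`, `L ⊆ M` excludes every `L` with odd elements.
    have hL1 : (Pi.single 0 (2 * 1), s * ((1 : ℤ) : K)) ∉ X := fun h =>
      hM1 (hX.medium_of_long h10 h)
    rcases hL with h | h | h | h | h
    · exact absurd ((h 1).2 (by decide)) hL1
    · exact ⟨2, 2, 0, key _ _ _ hM (liftL _ _ h), by simp⟩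
    · exact absurd ((h 1).2 (by decide)) hL1
    · exact ⟨2, 4, 0, key _ _ _ hM (liftL _ _ h), by simp⟩
    · exact ⟨2, 4, 2, key _ _ _ hM (liftL _ _ h), by simp⟩

end IsNormalizedSystem

/-! ### Isomorphisms by scaling and shearing. -/

theorem SystemIso.trans {K V V' V'' : Type*} [Field K] [AddCommGroup V] [Module K V]
    [AddCommGroup V'] [Module K V'] [AddCommGroup V''] [Module K V'']
    {B : LinearMap.BilinForm K V} {R : Set V} {B' : LinearMap.BilinForm K V'} {R' : Set V'}
    {B'' : LinearMap.BilinForm K V''} {R'' : Set V''}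
    (h : SystemIso B R B' R') (h' : SystemIso B' R' B'' R'') : SystemIso B R B'' R'' := by
  obtain ⟨ψ, hψ, a, ha, hB⟩ := h
  obtain ⟨ψ', hψ', a', ha', hB'⟩ := h'
  refine ⟨ψ.trans ψ', ?_, a' * a, mul_ne_zero ha' ha, fun v w => ?_⟩
  · rw [← hψ', ← hψ, Set.image_image]; rfl
  · rw [LinearEquiv.trans_apply, LinearEquiv.trans_apply, hB', hB, mul_assoc]

/-- The map that fixes `δ` up to the factor `s` and sends each `δ_i` to `δ_i + t δ`. -/
def scaleShear {K : Type*} [Field K] (n : ℕ) (s t : K) (hs : s ≠ 0) :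
    ((Fin n → K) × K) ≃ₗ[K] ((Fin n → K) × K) where
  toFun p := (p.1, s * p.2 + t * ∑ i, p.1 i)
  invFun p := (p.1, s⁻¹ * (p.2 - t * ∑ i, p.1 i))
  map_add' p q := by
    ext
    · simp
    · simp [Finset.sum_add_distrib]; ring
  map_smul' c p := by
    ext
    · simp
    · simp [← Finset.mul_sum]; ring
  left_inv p := by simp [hs]
  right_inv p := by simp [hs]

theorem systemIso_of_scaleShear {K : Type*} [Field K] {n : ℕ} {X Y : Set ((Fin n → K) × K)}
    {s : K} (t : K) (hs : s ≠ 0) (h : ∀ x c, (x, c) ∈ X ↔ (x, s * c + t * ∑ i, x i) ∈ Y) :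
    SystemIso (affineForm K n) X (affineForm K n) Y := by
  refine ⟨scaleShear n s t hs, ?_, 1, one_ne_zero, fun v w => (one_mul _).symm⟩
  ext p
  rw [LinearEquiv.image_eq_preimage_symm, Set.mem_preimage, ← Prod.mk.eta
    (p := (scaleShear n s t hs).symm p), h]
  exact iff_of_eq (congrArg (· ∈ Y) ((scaleShear n s t hs).apply_symm_apply p))

/-- The shear `δ_i ↦ δ_i + δ` moves short levels by `±1`, medium ones by `0` or `±2` and long ones
by `±2`. This preserves `ℤ` and `2ℤ` and exchanges `4ℤ + 2` with `4ℤ`. -/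
theorem systemIso_layered_four_two {K : Type*} [Field K] (n : ℕ) :
    SystemIso (affineForm K n)
      (layered n (progression K 1 0) (progression K 2 0) (progression K 4 2))
      (affineForm K n)
      (layered n (progression K 1 0) (progression K 2 0) (progression K 4 0)) := by
  have shift : ∀ {q r r' l : ℤ} {c e : K}, e = l → q ∣ l + r - r' →
      (c ∈ progression K q r ↔ c + e ∈ progression K q r') := by
    rintro q r r' l c e rfl ⟨k, hk⟩
    have hk' : (l : K) + r - r' = q * k := by exact_mod_cast congrArg (Int.cast (R := K)) hk
    constructor
    · rintro ⟨j, rfl⟩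
      refine ⟨j + k, ?_⟩
      push_cast
      linear_combination hk'
    · rintro ⟨j, hj⟩
      refine ⟨j - k, ?_⟩
      push_cast at hj ⊢
      linear_combination hj - hk'
  refine systemIso_of_scaleShear 1 one_ne_zero fun x c => ?_
  rw [one_mul, one_mul]
  refine or_congr (and_congr_right ?_) (or_congr (and_congr_right ?_) (and_congr_right ?_))
  · rintro ⟨i, s, hs, h⟩
    obtain rfl : x = _ := h
    rcases hs with rfl | rfl
    · exact shift (l := 1) (by simp) (by norm_num)
    · exact shift (l := -1) (by simp) (by norm_num)
  · rintro ⟨i, s, hs, j, -, t, ht, h⟩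
    obtain rfl : x = _ := h
    rcases hs with rfl | rfl <;> rcases ht with rfl | rfl
    · exact shift (l := 2) (by simp [Finset.sum_add_distrib]; norm_num) (by norm_num)
    · exact shift (l := 0) (by simp [Finset.sum_add_distrib]) (by norm_num)
    · exact shift (l := 0) (by simp [Finset.sum_add_distrib]) (by norm_num)
    · exact shift (l := -2) (by simp [Finset.sum_add_distrib]; norm_num) (by norm_num)
  · rintro ⟨i, s, hs, h⟩
    obtain rfl : x = _ := h
    rcases hs with rfl | rfl
    · exact shift (l := 2) (by simp) (by norm_num)
    · exact shift (l := -2) (by simp) (by norm_num)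

/-! ### From an affine generalized root system to a normalized one. -/

/-- Guarantees that every root of `R` is non-isotropic and so has a reflection preserving `R`. -/
theorem deltaForm_self_ne_zero {K : Type*} [Field K] [CharZero K] {n : ℕ} {x : Fin n → K}
    (hx : x ∈ rootsB0 K n) : deltaForm K n x x ≠ 0 := by
  change -∑ i, x i * x i ≠ 0
  rw [neg_ne_zero]
  have hsq : ∀ {s : K}, s ∈ ({1, -1} : Set K) → s * s = 1 := by rintro s (rfl | rfl) <;> simp
  rcases mem_rootsB0_iff.1 hx with ⟨i, s, hs, rfl⟩ | ⟨i, s, hs, j, hj, t, ht, rfl⟩ | ⟨i, s, hs, rfl⟩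
  · simp [Pi.single_apply, hsq hs]
  · have : ∑ k, (Pi.single i s + Pi.single j t : Fin n → K) k *
        (Pi.single i s + Pi.single j t : Fin n → K) k = 2 := by
      simp [Pi.single_apply, add_mul, mul_add, Finset.sum_add_distrib, hsq hs, hsq ht, hj, hj.symm]
      norm_num
    rw [this]; exact two_ne_zero
  · have : (2 * s) * (2 * s) = 4 := by linear_combination 4 * hsq hs
    simp [Pi.single_apply, this]

theorem map_rootReflection {K V V' : Type*} [Field K] [AddCommGroup V] [Module K V]
    [AddCommGroup V'] [Module K V'] {B : LinearMap.BilinForm K V} {B' : LinearMap.BilinForm K V'}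
    (ψ : V ≃ₗ[K] V') {a : K} (ha : a ≠ 0) (hB : ∀ v w, B' (ψ v) (ψ w) = a * B v w) (v w : V) :
    ψ (rootReflection B v w) = rootReflection B' (ψ v) (ψ w) := by
  simp only [rootReflection, map_sub, map_smul, hB]
  congr 2
  rw [mul_left_comm, mul_div_mul_left _ _ ha]

theorem exists_normalizedSystem {K V : Type*} [Field K] [CharZero K] [AddCommGroup V] [Module K V]
    {m : ℕ} {B : LinearMap.BilinForm K V} {R : Set V} (hR : IsAGRS B R)
    (hcl : SystemIso (quotForm B hR.symm) ((LinearMap.ker B).mkQ '' R)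
      (deltaForm K (m + 1)) (rootsB0 K (m + 1))) :
    ∃ X, IsNormalizedSystem X ∧ SystemIso B R (affineForm K (m + 1)) X := by
  obtain ⟨ψ, hψ, a, ha, hB⟩ := hcl
  let π : V →ₗ[K] (Fin (m + 1) → K) := ψ.toLinearMap ∘ₗ (LinearMap.ker B).mkQ
  have hπB : ∀ v w, deltaForm K (m + 1) (π v) (π w) = a * B v w := fun v w => hB _ _
  have hπ0 : ∀ v, π v = 0 ↔ v ∈ LinearMap.ker B := fun v => by
    simp [π]
  have hπR : ∀ v ∈ R, π v ∈ rootsB0 K (m + 1) := fun v hv => by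
    rw [← hψ]; exact ⟨_, ⟨v, hv, rfl⟩, rfl⟩
  have hπs : ∀ x ∈ rootsB0 K (m + 1), ∃ v ∈ R, π v = x := fun x hx => by
    rw [← hψ] at hx
    obtain ⟨_, ⟨v, hv, rfl⟩, rfl⟩ := hx
    exact ⟨v, hv, rfl⟩
  have hshort : (Pi.single 0 1 : Fin (m + 1) → K) ∈ rootsB0 K (m + 1) :=
    mem_rootsB0_iff.2 (.inl (single_mem_short 0))
  obtain ⟨e₀, he₀, hπe₀⟩ := hπs _ hshort
  -- The value `0` at `i = 0` makes `e₀ + g i` a lift of the basis vector `δ_{i+1}` for every `i`,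
  -- though for `i ≠ 0` this lift need not be a root.
  have hg : ∀ i : Fin (m + 1), ∃ v : V, (i = 0 → v = 0) ∧
      (i ≠ 0 → v ∈ R ∧ π v = Pi.single i 1 + Pi.single 0 (-1)) := fun i => by
    by_cases hi : i = 0
    · exact ⟨0, fun _ => rfl, fun h => absurd hi h⟩
    · obtain ⟨v, hv, hv'⟩ := hπs _ (mem_rootsB0_iff.2 (.inr (.inl
        (add_single_mem_medium (K := K) (Ne.symm hi) one_mem_signs neg_one_mem_signs))))
      exact ⟨v, fun h => absurd h hi, fun _ => ⟨hv, hv'⟩⟩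
  choose g hg0 hg1 using hg
  have hπe : ∀ i, π (e₀ + g i) = Pi.single i 1 := fun i => by
    by_cases hi : i = 0
    · rw [hg0 i hi, add_zero, hπe₀, hi]
    · rw [map_add, hπe₀, (hg1 i hi).2, Pi.single_neg]; abel
  obtain ⟨⟨z, hz⟩, hz0, hzs⟩ := finrank_eq_one_iff'.1 hR.finrank_ker
  have hz0 : z ≠ 0 := fun h => hz0 (Subtype.ext h)
  have hzs : ∀ v ∈ LinearMap.ker B, ∃ c : K, c • z = v := fun v hv => by
    obtain ⟨c, hc⟩ := hzs ⟨v, hv⟩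
    exact ⟨c, congrArg Subtype.val hc⟩
  let G : ((Fin (m + 1) → K) × K) →ₗ[K] V :=
    (Fintype.linearCombination K fun i => e₀ + g i).coprod (LinearMap.toSpanSingleton K V z)
  have hG : ∀ x c, G (x, c) = ∑ i, x i • (e₀ + g i) + c • z := fun x c => by
    simp [G, Fintype.linearCombination_apply]
  have hπG : ∀ p, π (G p) = p.1 := by
    rintro ⟨x, c⟩
    rw [hG, map_add, (hπ0 _).2 (Submodule.smul_mem _ _ hz), add_zero, map_sum]
    simp only [map_smul, hπe]
    ext k
    simp [Finset.sum_apply, Pi.single_apply]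
  have hbij : Function.Bijective G := by
    constructor
    · rw [injective_iff_map_eq_zero]
      rintro ⟨x, c⟩ h
      have hx : x = 0 := by
        have := hπG (x, c)
        rw [h, map_zero] at this
        exact this.symm
      subst hx
      rw [hG] at h
      simpa [hz0] using h
    · intro v
      obtain ⟨c, hc⟩ := hzs (v - G (π v, 0)) ((hπ0 _).1 (by rw [map_sub, hπG, sub_self]))
      refine ⟨(π v, c), ?_⟩
      rw [hG] at hc ⊢
      rw [hc]; simp
  let φ := (LinearEquiv.ofBijective G hbij).symm
  have hGφ : ∀ v, G (φ v) = v := (LinearEquiv.ofBijective G hbij).apply_symm_apply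
  have hφG : ∀ p, φ (G p) = p := (LinearEquiv.ofBijective G hbij).symm_apply_apply
  have hφ1 : ∀ v, (φ v).1 = π v := fun v => by rw [← hπG, hGφ]
  have hφB : ∀ v w, affineForm K (m + 1) (φ v) (φ w) = a * B v w := fun v w => by
    rw [← hπB, ← hφ1, ← hφ1]; rfl
  have hmem : ∀ p, G p ∈ R → p ∈ φ '' R := fun p h => ⟨G p, h, hφG p⟩
  have hmem' : ∀ p, p ∈ φ '' R → G p ∈ R := by
    rintro _ ⟨v, hv, rfl⟩
    rwa [hGφ]
  have hBR : ∀ v ∈ R, B v v ≠ 0 := fun v hv h => by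
    have := deltaForm_self_ne_zero (hπR v hv)
    rw [hπB, h, mul_zero] at this
    exact this rfl
  refine ⟨φ '' R, ⟨?_, ?_, ?_, ?_, ?_, ?_, ?_⟩, φ, rfl, a, ha, hφB⟩
  · rintro _ ⟨v, hv, rfl⟩
    rw [hφ1]; exact hπR v hv
  · intro x hx
    obtain ⟨v, hv, rfl⟩ := hπs x hx
    exact ⟨(φ v).2, v, hv, by rw [← hφ1]⟩
  · rintro _ ⟨v, hv, rfl⟩ _ ⟨w, hw, rfl⟩
    exact ⟨_, (hR.reflection v hv (hBR v hv) w hw).2, map_rootReflection φ ha hφB v w⟩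
  -- Since `e₀` has level `0`, the level of any other root over `δ_1` is its difference from `e₀`,
  -- measured in units of `z`.
  · obtain ⟨d, hd, hdisc⟩ := hR.discrete _ ⟨e₀, he₀, rfl⟩
    obtain ⟨d', rfl⟩ := hzs d hd
    refine ⟨d', fun c hc => ?_⟩
    have hGc := hmem' _ hc
    obtain ⟨k, hk⟩ := hdisc e₀ he₀ _ hGc rfl (ψ.injective (by
      change π _ = π _
      rw [hπG, hπe₀]))
    refine ⟨k, ?_⟩
    rw [hG] at hk
    simp [Pi.single_apply, Finset.sum_add_distrib, hg0 0 rfl] at hk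
    rw [← Int.cast_smul_eq_zsmul K, smul_smul] at hk
    exact smul_left_injective K hz0 hk
  -- If all levels were zero, `R` would lie in a hyperplane and could not span `V`.
  · by_contra! h
    have hle : Submodule.span K R ≤ LinearMap.ker (LinearMap.snd K (Fin (m + 1) → K) K ∘ₗ
        φ.toLinearMap) := Submodule.span_le.2 fun v hv => h _ ⟨v, hv, rfl⟩
    rw [hR.span_eq_top] at hle
    have := hle (Submodule.mem_top (x := G (0, 1)))
    rw [LinearMap.mem_ker] at this
    change (φ (G (0, 1))).2 = 0 at this
    rw [hφG] at this
    exact one_ne_zero this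
  · refine hmem _ ?_
    rw [hG]
    simpa [Pi.single_apply, Finset.sum_add_distrib, hg0 0 rfl] using he₀
  · intro i hi
    refine hmem _ ?_
    rw [hG]
    simpa [Pi.single_apply, add_smul, Finset.sum_add_distrib, hg0 0 rfl] using (hg1 i hi).1

/-! ### Matching the six combinations with the five families. -/

theorem corollary6p2p3 {K V : Type*} [Field K] [IsAlgClosed K] [CharZero K]
    [AddCommGroup V] [Module K V] (n : ℕ) (hn : 1 ≤ n)
    (B : LinearMap.BilinForm K V) (R : Set V) (hR : IsAGRS B R)
    (hcl : SystemIso (quotForm B hR.symm) ((LinearMap.ker B).mkQ '' R)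
      (deltaForm K n) (rootsB0 K n)) :
    SystemIso B R (affineForm K n) (realRootsB0 K n) ∨
    SystemIso B R (affineForm K n) (realRootsC2 K n) ∨
    SystemIso B R (affineForm K n) (realRootsA2 K n) ∨
    (2 ≤ n ∧ SystemIso B R (affineForm K n) (realRootsA0odd2 K n)) ∨
    SystemIso B R (affineForm K n) (realRootsA0even4 K n) := by
  obtain ⟨m, rfl⟩ : ∃ m, n = m + 1 := ⟨n - 1, by omega⟩
  obtain ⟨X, hX, hiso⟩ := exists_normalizedSystem hR hcl
  obtain ⟨s, hs, p, q, r, h, hpqr⟩ := hX.exists_mem_iff_mem_layered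
  -- Dividing levels by `s` makes the short levels exactly the integers.
  have hiso' := hiso.trans (systemIso_of_scaleShear 0 (inv_ne_zero hs) fun x c => by
    rw [zero_mul, add_zero, ← h, mul_inv_cancel_left₀ hs])
  rcases hpqr with ⟨rfl, rfl, rfl⟩ | ⟨rfl, rfl, rfl⟩ | ⟨rfl, rfl, rfl⟩ | ⟨hm, rfl, rfl, rfl⟩ |
    ⟨rfl, rfl, rfl⟩ | ⟨rfl, rfl, rfl⟩
  · exact .inl (by rwa [realRootsB0_eq_layered])
  · exact .inr (.inl (by rwa [realRootsC2_eq_layered]))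
  · exact .inr (.inr (.inl (by rwa [realRootsA2_eq_layered])))
  · obtain ⟨k, rfl⟩ : ∃ k, m = k + 1 := ⟨m - 1, by omega⟩
    exact .inr (.inr (.inr (.inl ⟨by omega, by rwa [realRootsA0odd2_eq_layered]⟩)))
  · exact .inr (.inr (.inr (.inr (by rwa [realRootsA0even4_eq_layered]))))
  · refine .inr (.inr (.inr (.inr ?_)))
    rw [realRootsA0even4_eq_layered]
    exact hiso'.trans (systemIso_layered_four_two (m + 1))
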